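/- Write $C_n$ for the cyclic group of order $n$, $D_{2n}$ for the dihedral group of order $2n$, $Q_8$ for the quaternion group of order $8$, $S_3$ for the symmetric group on three letters, and $A_4$ for the alternating group on four letters. A finite group $G$ has exactly $|G|-4$ cyclic subgroups (the trivial subgroup included) if and only if $G$ is isomorphic to one of the following eleven groups: $$C_4\times C_2\times C_2,\quad C_2\times C_2\times D_8,\quad (C_2\times C_2)\rtimes C_4,\quad Q_8\rtimes C_2,\quad C_3\times C_3,\quad (C_3\times C_3)\rtimes C_2,\quad A_4,\quad C_6\times C_2,\quad C_2\times C_2\times S_3,\quad C_8,\quad D_{16}.$$ Here the three semidirect products are the following. In $(C_2\times C_2)\rtimes C_4$, with $C_2\times C_2=\langle a\rangle\times\langle b\rangle$ and $C_4=\langle c\rangle$, one has $cac^{-1}=a$ and $cbc^{-1}=ab$. In $Q_8\rtimes C_2$, with $Q_8=\langle a,b \mid a^4=1,\ a^2=b^2,\ bab^{-1}=a^{-1}\rangle$ and $C_2=\langle c\rangle$, one has $cac^{-1}=a$ and $cbc^{-1}=a^2b$. In $(C_3\times C_3)\rtimes C_2$, the generator of $C_2$ inverts every element of $C_3\times C_3$.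 -/

import Mathlib

/-- The cyclic group of order `n` (for `n ≥ 1`), written multiplicatively. -/
abbrev Cyc (n : ℕ) : Type := Multiplicative (ZMod n)

/-- The action of `C₄` on `C₂ × C₂ = ⟨a⟩ × ⟨b⟩` in which a generator `c` of `C₄` fixes `a` and
sends `b` to `ab`. In additive coordinates `k ∈ ZMod 4` sends `(x, y)` to `(x + k y, y)`. -/
def shearAction : Cyc 4 →* MulAut (Cyc 2 × Cyc 2) where
  toFun k :=
    { toFun := fun p =>
        (p.1 * Multiplicative.ofAdd
          (ZMod.castHom (show 2 ∣ 4 by decide) (ZMod 2) k.toAdd * p.2.toAdd), p.2)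
      invFun := fun p =>
        (p.1 * Multiplicative.ofAdd
          (ZMod.castHom (show 2 ∣ 4 by decide) (ZMod 2) k.toAdd * p.2.toAdd), p.2)
      left_inv := by revert k; decide
      right_inv := by revert k; decide
      map_mul' := by revert k; decide }
  map_one' := by ext1 p; revert p; decide
  map_mul' := by intro j k; ext1 p; revert j k p; decide

/-- The action of `C₂` on `Q₈` in which the nontrivial element of `C₂` acts as conjugation by the
standard generator `a` of order `4`: it fixes `a` and sends the other generator `b` to
`a²b`. -/
def conjAction : Cyc 2 →* MulAut (QuaternionGroup 2) where
  toFun k := if k = 1 then 1 else MulAut.conj (QuaternionGroup.a 1)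
  map_one' := if_pos rfl
  map_mul' := by intro j k; ext1 p; revert j k p; decide

/-- The action of `C₂` on `C₃ × C₃` in which the nontrivial element of `C₂` inverts every
element. -/
def invAction : Cyc 2 →* MulAut (Cyc 3 × Cyc 3) where
  toFun k := if k = 1 then 1 else MulEquiv.inv (Cyc 3 × Cyc 3)
  map_one' := if_pos rfl
  map_mul' := by intro j k; ext1 p; revert j k p; decide

/-! A cyclic subgroup of order `n` has `φ(n)` generators, so the number of cyclic subgroups is the
sum of `1 / φ(o(g))` over all `g`. The condition thus says that the weights `1 - 1 / φ(o(g))` sum to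
`4` (`ncard_isCyclic_add_four_eq_iff`). The weight is `0` when `g ^ 2 = 1`, equals `1/2` for orders
`3`, `4`, `6`, and is larger for all other orders.

One cyclic subgroup cannot weigh more than `4`, which leaves orders dividing `4` or `6`, and orders
`5` and `8`. Order `5` is impossible (`orderOf_ne_five`). A cyclic subgroup of order `8` already
weighs `4`, so all elements outside it have square `1`, and `G` is `C₈` or `D₁₆`. In all remaining
cases the condition means that exactly eight elements have square different from `1`.

For fixed `g`, all but at most `2 * 8` elements `t` satisfy `t ^ 2 = (g * t) ^ 2 = 1`, and such a
`t` inverts `g`. If `|G| > 32`, this forces exponent `2`, a contradiction; as only the primes `2`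
and `3` divide `|G|`, the order is `9`, `12`, `16`, `18`, `24` or `32` (`card_cases`).

For orders `18`, `24` and `32` there is a subgroup of index `2` (a Sylow subgroup or a centralizer)
whose complement consists of elements of square `1`; these invert the subgroup, which is therefore
abelian, and the structure follows. Order `9` is immediate. Order `12` depends on whether a subgroup
of order `3` is normal, and order `16` on whether the elements of square `1` form a subgroup. In
each case an explicit injective homomorphism from the listed group is shown bijective by
cardinality. The converse is a finite computation. -/

/-! ### Weights of elements and the possible element orders -/

section Weights

variable {G : Type*} [Group G]

/-- The elements of square different from `1`. -/
def sqNeOne (G : Type*) [Group G] : Set G := {g | g ^ 2 ≠ 1}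

/-- The contribution of an element to the difference between the order of a finite group and its
number of cyclic subgroups. -/
noncomputable def cyclicWeight (g : G) : ℚ := 1 - 1 / (Nat.totient (orderOf g) : ℚ)

lemma one_le_totient_orderOf [Finite G] (g : G) : 1 ≤ Nat.totient (orderOf g) :=
  Nat.totient_pos.2 (orderOf_pos g)

lemma cyclicWeight_nonneg [Finite G] (g : G) : 0 ≤ cyclicWeight g := by
  have h : (1 : ℚ) ≤ Nat.totient (orderOf g) := by exact_mod_cast one_le_totient_orderOf g
  rw [cyclicWeight, sub_nonneg, div_le_one (by linarith)]
  exact h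

lemma cyclicWeight_of_totient {g : G} {k : ℕ} (h : Nat.totient (orderOf g) = k) :
    cyclicWeight g = 1 - 1 / (k : ℚ) := by rw [cyclicWeight, h]

lemma totient_orderOf_of_sq_eq_one {g : G} (h : g ^ 2 = 1) : Nat.totient (orderOf g) = 1 := by
  have := orderOf_dvd_of_pow_eq_one h
  have h2 := Nat.le_of_dvd (by norm_num) this
  have h0 : orderOf g ≠ 0 := fun h0 => by simp [h0] at this
  interval_cases orderOf g <;> first | rfl | omega

lemma two_le_totient_orderOf_of_sq_ne_one [Finite G] {g : G} (h : g ^ 2 ≠ 1) :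
    2 ≤ Nat.totient (orderOf g) := by
  have h1 := one_le_totient_orderOf g
  by_contra h2
  have h3 : Nat.totient (orderOf g) = 1 := by omega
  rcases Nat.totient_eq_one_iff.1 h3 with h4 | h4
  · exact h (by simp [orderOf_eq_one_iff.1 h4])
  · exact h (by rw [← h4, pow_orderOf_eq_one])

lemma cyclicWeight_of_sq_eq_one {g : G} (h : g ^ 2 = 1) : cyclicWeight g = 0 := by
  rw [cyclicWeight_of_totient (totient_orderOf_of_sq_eq_one h)]; norm_num

lemma half_le_cyclicWeight [Finite G] {g : G} (h : g ^ 2 ≠ 1) : 1 / 2 ≤ cyclicWeight g := by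
  have h1 : (2 : ℚ) ≤ Nat.totient (orderOf g) := by
    exact_mod_cast two_le_totient_orderOf_of_sq_ne_one h
  rw [cyclicWeight]
  have := one_div_le_one_div_of_le (by norm_num) h1
  linarith

lemma sq_eq_one_of_cyclicWeight_eq_zero [Finite G] {g : G} (h : cyclicWeight g = 0) :
    g ^ 2 = 1 := by
  by_contra h2
  have := half_le_cyclicWeight h2
  linarith

/-- Gives the size of the fibres of `g ↦ ⟨g⟩`; each fibre then contributes exactly `1` to the sum of
`1 / φ(o(g))`. -/
lemma card_zpowers_eq_zpowers [Fintype G] (x : G)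
    [DecidablePred fun g : G => Subgroup.zpowers g = Subgroup.zpowers x] :
    (Finset.univ.filter fun g : G => Subgroup.zpowers g = Subgroup.zpowers x).card =
      Nat.totient (orderOf x) := by
  classical
  have h := IsCyclic.card_orderOf_eq_totient (α := Subgroup.zpowers x) (d := orderOf x)
    (by rw [Fintype.card_zpowers])
  rw [← h]
  symm
  refine Finset.card_bij (fun (a : Subgroup.zpowers x) _ => (a : G)) ?_ ?_ ?_
  · intro a ha
    simp only [Finset.mem_filter, Finset.mem_univ, true_and] at ha ⊢
    refine Subgroup.eq_of_le_of_card_ge (by simp) ?_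
    rw [Nat.card_zpowers, Nat.card_zpowers, Subgroup.orderOf_coe, ha]
  · intro a _ b _ hab
    exact Subtype.ext hab
  · intro b hb
    simp only [Finset.mem_filter, Finset.mem_univ, true_and] at hb
    refine ⟨⟨b, hb ▸ Subgroup.mem_zpowers b⟩, ?_, rfl⟩
    simp only [Finset.mem_filter, Finset.mem_univ, true_and, Subgroup.orderOf_mk]
    rw [← Nat.card_zpowers, hb, Nat.card_zpowers]

lemma sum_cyclicWeight [Fintype G] :
    ∑ g : G, cyclicWeight g =
      (Nat.card G : ℚ) - ({H : Subgroup G | IsCyclic H}.ncard : ℚ) := by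
  classical
  have h1 : {H : Subgroup G | IsCyclic H} =
      ((Finset.univ.image fun g : G => Subgroup.zpowers g : Finset (Subgroup G)) :
        Set (Subgroup G)) := by
    ext H
    simp [Subgroup.isCyclic_iff_exists_zpowers_eq_top]
  have h2 : ∑ g : G, 1 / (Nat.totient (orderOf g) : ℚ) =
      ((Finset.univ.image fun g : G => Subgroup.zpowers g).card : ℚ) := by
    rw [Finset.card_eq_sum_ones, Nat.cast_sum,
      ← Finset.sum_fiberwise_of_maps_to (s := Finset.univ) (g := fun g : G => Subgroup.zpowers g)
        (t := Finset.univ.image fun g : G => Subgroup.zpowers g)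
        (fun x hx => Finset.mem_image_of_mem _ hx)]
    refine Finset.sum_congr rfl fun H hH => ?_
    obtain ⟨x, -, rfl⟩ := Finset.mem_image.1 hH
    have h3 : ∀ g ∈ Finset.univ.filter fun g : G => Subgroup.zpowers g = Subgroup.zpowers x,
        1 / (Nat.totient (orderOf g) : ℚ) = 1 / (Nat.totient (orderOf x) : ℚ) := by
      intro g hg
      rw [← Nat.card_zpowers, (Finset.mem_filter.1 hg).2, Nat.card_zpowers]
    rw [Finset.sum_congr rfl h3, Finset.sum_const, card_zpowers_eq_zpowers, nsmul_eq_mul]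
    have : (Nat.totient (orderOf x) : ℚ) ≠ 0 := by
      have := one_le_totient_orderOf x
      positivity
    field_simp
    simp
  rw [h1, Set.ncard_coe_finset, ← h2]
  simp only [cyclicWeight, Finset.sum_sub_distrib]
  simp

lemma ncard_isCyclic_add_four_eq_iff [Fintype G] :
    {H : Subgroup G | IsCyclic H}.ncard + 4 = Nat.card G ↔ ∑ g : G, cyclicWeight g = 4 := by
  rw [sum_cyclicWeight, sub_eq_iff_eq_add, add_comm, ← @Nat.cast_inj ℚ, eq_comm]
  push_cast
  rfl

lemma sum_cyclicWeight_of_totient_le [Fintype G]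
    (h : ∀ g : G, g ^ 2 ≠ 1 → Nat.totient (orderOf g) = 2) :
    ∑ g : G, cyclicWeight g = (sqNeOne G).ncard / 2 := by
  classical
  have h1 : ∀ g : G, cyclicWeight g = if g ^ 2 ≠ 1 then 1 / 2 else 0 := by
    intro g
    split_ifs with hg
    · rw [cyclicWeight_of_totient (h g hg)]; norm_num
    · exact cyclicWeight_of_sq_eq_one (not_not.1 hg)
  have h2 : sqNeOne G = (Finset.univ.filter fun g : G => g ^ 2 ≠ 1 : Finset G) := by
    ext; simp [sqNeOne]
  rw [h2, Set.ncard_coe_finset, Finset.sum_congr rfl fun g _ => h1 g, ← Finset.sum_filter,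
    Finset.sum_const, nsmul_eq_mul]
  ring

lemma sum_zpowers_eq_sum_range [Fintype G] [DecidableEq G] (x : G) (f : G → ℚ) :
    ∑ g ∈ (Finset.range (orderOf x)).image (x ^ ·), f g =
      ∑ i ∈ Finset.range (orderOf x), f (x ^ i) := by
  refine Finset.sum_image fun i hi j hj hij => ?_
  simp only [Finset.coe_range, Set.mem_Iio] at hi hj
  exact pow_injOn_Iio_orderOf hi hj hij

lemma totient_orderOf_of_pow_eq_one {g : G} (h : g ^ 4 = 1 ∨ g ^ 6 = 1) (h2 : g ^ 2 ≠ 1) :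
    Nat.totient (orderOf g) = 2 := by
  have h3 : ¬ orderOf g ∣ 2 := fun h => h2 (orderOf_dvd_iff_pow_eq_one.1 h)
  rcases h with h | h <;>
  · have h4 := orderOf_dvd_of_pow_eq_one h
    have h5 := Nat.le_of_dvd (by norm_num) h4
    interval_cases orderOf g <;> revert h3 h4 <;> decide

lemma ncard_isCyclic_add_four_eq_of_ncard_sqNeOne [Finite G]
    (h : ∀ g : G, g ^ 4 = 1 ∨ g ^ 6 = 1) (h8 : (sqNeOne G).ncard = 8) :
    {H : Subgroup G | IsCyclic H}.ncard + 4 = Nat.card G := by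
  have := Fintype.ofFinite G
  rw [ncard_isCyclic_add_four_eq_iff, sum_cyclicWeight_of_totient_le
    fun g => totient_orderOf_of_pow_eq_one (h g), h8]
  norm_num

/-- At most two of the `n` powers of `x` have square `1`, and each of the others weighs at least
`1/2`, so `(n - 2) / 2 ≤ 4`. -/
lemma orderOf_le_ten [Fintype G] (h : ∑ g : G, cyclicWeight g = 4) (x : G) :
    orderOf x ≤ 10 := by
  classical
  have h1 : ∑ i ∈ Finset.range (orderOf x), cyclicWeight (x ^ i) ≤ 4 := by
    rw [← h, ← sum_zpowers_eq_sum_range]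
    exact Finset.sum_le_univ_sum_of_nonneg cyclicWeight_nonneg
  set n := orderOf x with hn
  have h2 : (Finset.range n).filter (fun i => (x ^ i) ^ 2 = 1) ⊆ {0, n / 2} := by
    intro i hi
    simp only [Finset.mem_filter, Finset.mem_range, ← pow_mul] at hi
    obtain ⟨k, hk⟩ := orderOf_dvd_of_pow_eq_one hi.2
    rw [← hn] at hk
    have : k < 2 := by
      by_contra hk2
      have : n * 2 ≤ n * k := Nat.mul_le_mul_left _ (by omega)
      omega
    simp only [Finset.mem_insert, Finset.mem_singleton]
    interval_cases k <;> omega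
  have h3 := (Finset.card_le_card h2).trans Finset.card_le_two
  have h4 := Finset.card_filter_add_card_filter_not (s := Finset.range n)
    (fun i => (x ^ i) ^ 2 = 1)
  rw [Finset.card_range] at h4
  have h5 : (((Finset.range n).filter fun i => ¬ (x ^ i) ^ 2 = 1).card : ℚ) * (1 / 2) ≤
      ∑ i ∈ Finset.range n, cyclicWeight (x ^ i) := by
    rw [← nsmul_eq_mul, ← Finset.sum_const]
    refine (Finset.sum_le_sum fun i hi => half_le_cyclicWeight (Finset.mem_filter.1 hi).2).trans ?_
    exact Finset.sum_le_sum_of_subset_of_nonneg (Finset.filter_subset _ _)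
      fun i _ _ => cyclicWeight_nonneg _
  have h6 : (((Finset.range n).filter fun i => ¬ (x ^ i) ^ 2 = 1).card : ℚ) ≤ 8 := by linarith
  have h7 : ((Finset.range n).filter fun i => ¬ (x ^ i) ^ 2 = 1).card ≤ 8 := by exact_mod_cast h6
  omega

lemma sum_zpowers_cyclicWeight [Finite G] (x : G) :
    ∑ i ∈ Finset.range (orderOf x), cyclicWeight (x ^ i) =
      ∑ i ∈ Finset.range (orderOf x),
        (1 - 1 / (Nat.totient (orderOf x / Nat.gcd (orderOf x) i) : ℚ)) := by
  simp only [cyclicWeight, orderOf_pow]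

lemma orderOf_cases [Fintype G] (h : ∑ g : G, cyclicWeight g = 4) (x : G) :
    (x ^ 4 = 1 ∨ x ^ 6 = 1) ∨ orderOf x = 5 ∨ orderOf x = 8 := by
  classical
  have h0 := orderOf_le_ten h x
  have h1 : ∑ i ∈ Finset.range (orderOf x), cyclicWeight (x ^ i) ≤ 4 := by
    rw [← h, ← sum_zpowers_eq_sum_range]
    exact Finset.sum_le_univ_sum_of_nonneg cyclicWeight_nonneg
  rw [sum_zpowers_cyclicWeight] at h1
  have h2 := orderOf_pos x
  simp only [← orderOf_dvd_iff_pow_eq_one]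
  have t2 : Nat.totient 2 = 1 := by decide
  have t3 : Nat.totient 3 = 2 := by decide
  have t5 : Nat.totient 5 = 4 := by decide
  have t7 : Nat.totient 7 = 6 := by decide
  have t9 : Nat.totient 9 = 6 := by decide
  have t10 : Nat.totient 10 = 4 := by decide
  generalize orderOf x = n at *
  interval_cases n
  -- For orders `7`, `9` and `10` the powers of `x` alone weigh `5`, `6` and `6`.
  all_goals first
    | (left; decide)
    | (right; decide)
    | (norm_num [Finset.sum_range_succ, t2, t3, t5, t7, t9, t10] at h1)

end Weights

/-! ### Elements of order five and eight -/

section OrderFiveEight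

variable {G : Type*} [Group G]

lemma sum_cyclicWeight_eq_add [Fintype G] [DecidableEq G] (x : G) :
    ∑ g : G, cyclicWeight g =
      ∑ i ∈ Finset.range (orderOf x), cyclicWeight (x ^ i) +
        ∑ g ∈ Finset.univ \ (Finset.range (orderOf x)).image (x ^ ·), cyclicWeight g := by
  rw [← sum_zpowers_eq_sum_range, add_comm, Finset.sum_sdiff (Finset.subset_univ _)]

lemma mem_sdiff_image_pow [Fintype G] [DecidableEq G] (x g : G) :
    g ∈ Finset.univ \ (Finset.range (orderOf x)).image (x ^ ·) ↔ g ∉ Subgroup.zpowers x := by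
  rw [mem_zpowers_iff_mem_range_orderOf]
  simp

lemma sum_zpowers_cyclicWeight_of_orderOf_eq_eight [Finite G] {x : G} (h : orderOf x = 8) :
    ∑ i ∈ Finset.range (orderOf x), cyclicWeight (x ^ i) = 4 := by
  rw [sum_zpowers_cyclicWeight, h]
  have t2 : Nat.totient 2 = 1 := by decide
  have t4 : Nat.totient 4 = 2 := by decide
  have t8 : Nat.totient 8 = 4 := by decide
  norm_num [Finset.sum_range_succ, t2, t4, t8]

lemma sum_zpowers_cyclicWeight_of_orderOf_eq_five [Finite G] {x : G} (h : orderOf x = 5) :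
    ∑ i ∈ Finset.range (orderOf x), cyclicWeight (x ^ i) = 3 := by
  rw [sum_zpowers_cyclicWeight, h]
  have t5 : Nat.totient 5 = 4 := by decide
  norm_num [Finset.sum_range_succ, t5]

lemma sum_cyclicWeight_eq_four_iff_of_orderOf_eq_eight [Fintype G] {x : G}
    (hx : orderOf x = 8) :
    ∑ g : G, cyclicWeight g = 4 ↔ ∀ g ∉ Subgroup.zpowers x, g ^ 2 = 1 := by
  classical
  rw [sum_cyclicWeight_eq_add x, sum_zpowers_cyclicWeight_of_orderOf_eq_eight hx, add_eq_left,
    Finset.sum_eq_zero_iff_of_nonneg fun g _ => cyclicWeight_nonneg g]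
  simp only [mem_sdiff_image_pow]
  exact forall₂_congr fun g _ => ⟨sq_eq_one_of_cyclicWeight_eq_zero, cyclicWeight_of_sq_eq_one⟩

/-- The powers of `x` weigh `3`, leaving `1` for the rest, so outside `⟨x⟩` the elements of square
different from `1` are just some `y` and `y⁻¹`. Conjugation by `x` permutes this pair and has odd
order, so `x` commutes with `y`; the elements `x ^ i * y` then give a contradiction. -/
lemma orderOf_ne_five [Fintype G] (h : ∑ g : G, cyclicWeight g = 4) (x : G) :
    orderOf x ≠ 5 := by
  classical
  intro hx
  rw [sum_cyclicWeight_eq_add x, sum_zpowers_cyclicWeight_of_orderOf_eq_five hx] at h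
  have h1 : ∑ g ∈ Finset.univ \ (Finset.range (orderOf x)).image (x ^ ·), cyclicWeight g = 1 := by
    linarith
  obtain ⟨y, hyP, hy2⟩ : ∃ y ∉ Subgroup.zpowers x, y ^ 2 ≠ 1 := by
    by_contra! hcon
    rw [Finset.sum_eq_zero fun g hg => cyclicWeight_of_sq_eq_one
      (hcon g ((mem_sdiff_image_pow x g).1 hg))] at h1
    norm_num at h1
  have hyinv : y⁻¹ ≠ y := fun h => hy2 (by rw [sq]; nth_rewrite 1 [← h]; simp)
  have hB : ∀ z ∉ Subgroup.zpowers x, z ^ 2 ≠ 1 → z = y ∨ z = y⁻¹ := by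
    intro z hz hz2
    by_contra! hcon
    have hsub : ({z, y, y⁻¹} : Finset G) ⊆
        Finset.univ \ (Finset.range (orderOf x)).image (x ^ ·) := by
      intro g hg
      simp only [Finset.mem_insert, Finset.mem_singleton] at hg
      rw [mem_sdiff_image_pow]
      rcases hg with rfl | rfl | rfl
      · exact hz
      · exact hyP
      · simpa using hyP
    have h2 := Finset.sum_le_sum_of_subset_of_nonneg hsub
      (f := cyclicWeight) fun i _ _ => cyclicWeight_nonneg i
    rw [h1, Finset.sum_insert (by simp [hcon.1, hcon.2]), Finset.sum_insert (by simp [hyinv.symm]),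
      Finset.sum_singleton] at h2
    have a1 := half_le_cyclicWeight hz2
    have a2 := half_le_cyclicWeight hy2
    have a3 := half_le_cyclicWeight (g := y⁻¹) (by simpa using hy2)
    linarith
  have hx5 : x ^ 5 = 1 := by rw [← hx, pow_orderOf_eq_one]
  have hxmem := Subgroup.mem_zpowers x
  have hcomm : x * y = y * x := by
    have hz := hB (x * y * x⁻¹)
      (fun hm => hyP (by
        have := mul_mem (mul_mem (inv_mem hxmem) hm) hxmem
        simpa [mul_assoc] using this))
      (fun hm => hy2 (by
        have h3 : x * y ^ 2 * x⁻¹ = 1 := by rw [← hm, conj_pow]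
        simpa [mul_inv_eq_one] using h3))
    rcases hz with hz | hz
    · exact mul_inv_eq_iff_eq_mul.1 hz
    · exfalso
      have e1 : x * y * x⁻¹ = y⁻¹ := hz
      have e2 : x * y⁻¹ * x⁻¹ = y := by
        rw [← conj_inv, e1, inv_inv]
      have e5 : x ^ 5 * y * (x ^ 5)⁻¹ = y⁻¹ := by
        calc x ^ 5 * y * (x ^ 5)⁻¹
            = x * (x * (x * (x * (x * y * x⁻¹) * x⁻¹) * x⁻¹) * x⁻¹) * x⁻¹ := by
              simp only [pow_succ, pow_zero, one_mul, mul_inv_rev, mul_assoc]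
          _ = y⁻¹ := by rw [e1, e2, e1, e2, e1]
      rw [hx5] at e5
      exact hyinv (by simpa using e5.symm)
  -- The element `x ^ i * y` lies outside `⟨x⟩` and differs from `y`, so it has square `1` or equals
  -- `y⁻¹`.
  have key : ∀ i : ℕ, 0 < i → i < 5 → (y ^ 2)⁻¹ = x ^ i ∨ (y ^ 2)⁻¹ = x ^ (2 * i) := by
    intro i hi0 hi5
    have hc : Commute (x ^ i) y := Commute.pow_left hcomm i
    by_cases hs : (x ^ i * y) ^ 2 = 1
    · right
      rw [hc.mul_pow, ← pow_mul, mul_comm i] at hs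
      exact (eq_inv_of_mul_eq_one_left hs).symm
    · rcases hB (x ^ i * y) (fun hm => hyP (by
        have := mul_mem (inv_mem (pow_mem hxmem i)) hm
        simpa using this)) hs with h3 | h3
      · have : orderOf x ∣ i := orderOf_dvd_of_pow_eq_one (by simpa using h3)
        rw [hx] at this
        have := Nat.le_of_dvd hi0 this
        omega
      · left
        rw [← mul_inv_eq_iff_eq_mul.2 h3.symm, sq, mul_inv_rev]
  have hinj : ∀ i j : ℕ, x ^ i = x ^ j → i % 5 = j % 5 := by
    intro i j hij
    have := pow_eq_pow_iff_modEq.1 hij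
    rwa [hx] at this
  -- The exponent of `(y ^ 2)⁻¹` modulo `5` would lie in `{1, 2}`, `{2, 4}` and `{3, 1}` at once.
  rcases key 1 (by norm_num) (by norm_num) with a | a <;>
  rcases key 2 (by norm_num) (by norm_num) with b | b <;>
  rcases key 3 (by norm_num) (by norm_num) with c | c <;>
  · have h1 := hinj _ _ (a.symm.trans b)
    have h2 := hinj _ _ (b.symm.trans c)
    omega

end OrderFiveEight

/-! ### Homomorphisms from cyclic, dihedral and quaternion groups -/

section Homs

variable {G : Type*} [Group G]

/-- The homomorphism from a cyclic group sending the standard generator to `x`. -/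
def cycHom (n : ℕ) (x : G) (hx : x ^ n = 1) : Cyc n →* G :=
  AddMonoidHom.toMultiplicativeLeft (ZMod.lift n ⟨zmultiplesHom (Additive G) (Additive.ofMul x), by
    simp only [zmultiplesHom_apply, natCast_zsmul]
    rw [← ofMul_pow, hx, ofMul_one]⟩)

lemma cycHom_intCast {n : ℕ} {x : G} (hx : x ^ n = 1) (k : ℤ) :
    cycHom n x hx (Multiplicative.ofAdd (k : ZMod n)) = x ^ k := by
  simp [cycHom]

lemma exists_cycHom_eq_zpow {n : ℕ} {x : G} (hx : x ^ n = 1) (a : Cyc n) :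
    ∃ k : ℤ, a = Multiplicative.ofAdd (k : ZMod n) ∧ cycHom n x hx a = x ^ k := by
  obtain ⟨k, hk⟩ := ZMod.intCast_surjective a.toAdd
  have : a = Multiplicative.ofAdd (k : ZMod n) := by rw [hk]; rfl
  exact ⟨k, this, by rw [this, cycHom_intCast]⟩

lemma cycHom_one {n : ℕ} {x : G} (hx : x ^ n = 1) :
    cycHom n x hx (Multiplicative.ofAdd 1) = x := by
  have := cycHom_intCast hx 1
  simpa using this

lemma cycHom_mem_zpowers {n : ℕ} {x : G} (hx : x ^ n = 1) (a : Cyc n) :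
    cycHom n x hx a ∈ Subgroup.zpowers x := by
  obtain ⟨k, -, hk⟩ := exists_cycHom_eq_zpow hx a
  exact hk ▸ Subgroup.zpow_mem_zpowers x k

lemma cycHom_injective {n : ℕ} {x : G} (hx : x ^ n = 1) (ho : orderOf x = n) :
    Function.Injective (cycHom n x hx) := by
  rw [injective_iff_map_eq_one]
  intro a ha
  obtain ⟨k, rfl, hk⟩ := exists_cycHom_eq_zpow hx a
  rw [hk] at ha
  have := orderOf_dvd_iff_zpow_eq_one.2 ha
  rw [ho, ← ZMod.intCast_zmod_eq_zero_iff_dvd] at this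
  rw [this, ofAdd_zero]

lemma mul_cycHom_mul_of_inverts {n : ℕ} {x s : G} (hx : x ^ n = 1) (hs : s * x = x⁻¹ * s)
    (a : Cyc n) : cycHom n x hx a * s = s * cycHom n x hx a⁻¹ := by
  obtain ⟨k, -, hk⟩ := exists_cycHom_eq_zpow hx a
  have h1 : SemiconjBy s x x⁻¹ := hs
  have h2 := (h1.zpow_right (-k)).eq
  rw [map_inv, hk, ← zpow_neg, h2, inv_zpow', neg_neg]

/-- The homomorphism from a dihedral group given by images of the standard generators. -/
def dihedralHom (n : ℕ) (x s : G) (hx : x ^ n = 1) (hs : s * s = 1) (hsx : s * x = x⁻¹ * s) :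
    DihedralGroup n →* G where
  toFun
    | .r i => cycHom n x hx (Multiplicative.ofAdd i)
    | .sr i => s * cycHom n x hx (Multiplicative.ofAdd i)
  map_one' := by
    rw [DihedralGroup.one_def]
    exact map_one _
  map_mul' := by
    have h := mul_cycHom_mul_of_inverts hx hsx
    rintro (i | i) (j | j)
    · simp only [DihedralGroup.r_mul_r, ofAdd_add, map_mul]
    · simp only [DihedralGroup.r_mul_sr]
      rw [← mul_assoc, h, mul_assoc, ← map_mul, sub_eq_neg_add, ofAdd_add, ofAdd_neg]
    · simp only [DihedralGroup.sr_mul_r, ofAdd_add, map_mul, mul_assoc]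
    · simp only [DihedralGroup.sr_mul_sr]
      rw [mul_assoc, ← mul_assoc _ s, h, mul_assoc, ← mul_assoc, hs, one_mul, ← map_mul,
        sub_eq_neg_add, ofAdd_add, ofAdd_neg]

lemma dihedralHom_injective {n : ℕ} {x s : G} (hx : x ^ n = 1) (hs : s * s = 1)
    (hsx : s * x = x⁻¹ * s) (ho : orderOf x = n) (hmem : s ∉ Subgroup.zpowers x) :
    Function.Injective (dihedralHom n x s hx hs hsx) := by
  rw [injective_iff_map_eq_one]
  rintro (i | i) hi
  · have := (injective_iff_map_eq_one _).1 (cycHom_injective hx ho) _ hi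
    rw [DihedralGroup.one_def, ← ofAdd_eq_one.1 this]
  · refine absurd ?_ hmem
    rw [eq_inv_of_mul_eq_one_left hi]
    exact inv_mem (cycHom_mem_zpowers hx _)

/-- The homomorphism from a generalized quaternion group given by images of the standard
generators. -/
def quaternionHom (n : ℕ) (x s : G) (hx : x ^ (2 * n) = 1) (hs : s * s = x ^ n)
    (hsx : s * x = x⁻¹ * s) : QuaternionGroup n →* G where
  toFun
    | .a i => cycHom (2 * n) x hx (Multiplicative.ofAdd i)
    | .xa i => s * cycHom (2 * n) x hx (Multiplicative.ofAdd i)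
  map_one' := by
    rw [QuaternionGroup.one_def]
    exact map_one _
  map_mul' := by
    have h := mul_cycHom_mul_of_inverts hx hsx
    have hn : cycHom (2 * n) x hx (Multiplicative.ofAdd (n : ZMod (2 * n))) = x ^ n := by
      have := cycHom_intCast hx n
      simpa using this
    rintro (i | i) (j | j)
    · simp only [QuaternionGroup.a_mul_a, ofAdd_add, map_mul]
    · simp only [QuaternionGroup.a_mul_xa]
      rw [← mul_assoc, h, mul_assoc, ← map_mul, sub_eq_neg_add, ofAdd_add, ofAdd_neg]
    · simp only [QuaternionGroup.xa_mul_a, ofAdd_add, map_mul, mul_assoc]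
    · simp only [QuaternionGroup.xa_mul_xa]
      rw [mul_assoc, ← mul_assoc _ s, h, mul_assoc, ← mul_assoc, hs, ← map_mul, ← hn, ← map_mul,
        add_sub_assoc, sub_eq_neg_add, ofAdd_add, ofAdd_add, ofAdd_neg]

lemma quaternionHom_injective {n : ℕ} {x s : G} (hx : x ^ (2 * n) = 1) (hs : s * s = x ^ n)
    (hsx : s * x = x⁻¹ * s) (ho : orderOf x = 2 * n) (hmem : s ∉ Subgroup.zpowers x) :
    Function.Injective (quaternionHom n x s hx hs hsx) := by
  rw [injective_iff_map_eq_one]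
  rintro (i | i) hi
  · have := (injective_iff_map_eq_one _).1 (cycHom_injective hx ho) _ hi
    rw [QuaternionGroup.one_def, ← ofAdd_eq_one.1 this]
  · refine absurd ?_ hmem
    rw [eq_inv_of_mul_eq_one_left hi]
    exact inv_mem (cycHom_mem_zpowers hx _)

lemma nonempty_mulEquiv_of_injective {H : Type*} [Group H] [Finite G] (f : H →* G)
    (hf : Function.Injective f) (hcard : Nat.card H = Nat.card G) : Nonempty (G ≃* H) := by
  have hb : Function.Bijective f := (Nat.bijective_iff_injective_and_card f).2 ⟨hf, hcard⟩
  exact ⟨(MulEquiv.ofBijective f hb).symm⟩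

end Homs

/-! ### The listed groups satisfy the condition -/

section Examples

variable {G : Type*} [Group G]

/-- The hypotheses use products instead of powers so that they can be decided by evaluation in a
concrete `H`. -/
lemma ncard_isCyclic_of_mulEquiv {H : Type*} [Group H] [Fintype H] [DecidableEq H] (e : G ≃* H)
    (h : ∀ g : H, g * g * (g * g) = 1 ∨ g * g * (g * g) * (g * g) = 1)
    (h8 : (Finset.univ.filter fun g : H => g * g ≠ 1).card = 8) :
    {K : Subgroup G | IsCyclic K}.ncard + 4 = Nat.card G := by
  have := Finite.of_equiv H e.symm.toEquiv
  refine ncard_isCyclic_add_four_eq_of_ncard_sqNeOne (fun g => ?_) ?_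
  · rw [← e.injective.eq_iff, ← e.injective.eq_iff (a := g ^ 6), map_pow, map_pow, map_one]
    rcases h (e g) with h | h
    · exact Or.inl (by rw [← h]; simp only [pow_succ, pow_zero, one_mul, mul_assoc])
    · exact Or.inr (by rw [← h]; simp only [pow_succ, pow_zero, one_mul, mul_assoc])
  · rw [← h8, ← Set.ncard_coe_finset, ← Set.ncard_image_of_injective _ e.injective]
    congr 1
    ext y
    simp only [sqNeOne, Set.mem_image, Set.mem_ofPred_eq, Finset.coe_filter, Finset.mem_univ,
      true_and, ← sq]
    constructor
    · rintro ⟨g, hg, rfl⟩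
      rw [← map_pow]
      exact fun h => hg ((map_eq_one_iff e e.injective).1 h)
    · intro hy
      refine ⟨e.symm y, fun h => hy ?_, e.apply_symm_apply y⟩
      rw [← map_pow, map_eq_one_iff _ e.symm.injective] at h
      exact h

lemma ncard_isCyclic_of_mulEquiv_of_orderOf_eq_eight {H : Type*} [Group H] [Finite H]
    (e : G ≃* H) (x : H) (hx : orderOf x = 8) (h : ∀ g ∉ Subgroup.zpowers x, g * g = 1) :
    {K : Subgroup G | IsCyclic K}.ncard + 4 = Nat.card G := by
  have := Finite.of_equiv H e.symm.toEquiv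
  have := Fintype.ofFinite G
  rw [ncard_isCyclic_add_four_eq_iff, sum_cyclicWeight_eq_four_iff_of_orderOf_eq_eight
    (x := e.symm x) (by rw [MulEquiv.orderOf_eq, hx])]
  intro g hg
  have h1 : e g ∉ Subgroup.zpowers x := by
    rintro ⟨k, hk⟩
    refine hg ⟨k, ?_⟩
    simp only at hk ⊢
    rw [← map_zpow, hk, e.symm_apply_apply]
  have h2 := h _ h1
  rwa [← map_mul, map_eq_one_iff e e.injective, ← sq] at h2

instance {N K : Type*} [Group N] [Group K] [Fintype N] [Fintype K] (φ : K →* MulAut N) :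
    Fintype (N ⋊[φ] K) := Fintype.ofEquiv _ SemidirectProduct.equivProd.symm

lemma ncard_isCyclic_of_listed_mulEquiv
    (h : Nonempty (G ≃* Cyc 4 × Cyc 2 × Cyc 2) ∨
       Nonempty (G ≃* Cyc 2 × Cyc 2 × DihedralGroup 4) ∨
       Nonempty (G ≃* (Cyc 2 × Cyc 2) ⋊[shearAction] Cyc 4) ∨
       Nonempty (G ≃* QuaternionGroup 2 ⋊[conjAction] Cyc 2) ∨
       Nonempty (G ≃* Cyc 3 × Cyc 3) ∨
       Nonempty (G ≃* (Cyc 3 × Cyc 3) ⋊[invAction] Cyc 2) ∨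
       Nonempty (G ≃* alternatingGroup (Fin 4)) ∨
       Nonempty (G ≃* Cyc 6 × Cyc 2) ∨
       Nonempty (G ≃* Cyc 2 × Cyc 2 × Equiv.Perm (Fin 3)) ∨
       Nonempty (G ≃* Cyc 8) ∨
       Nonempty (G ≃* DihedralGroup 8)) :
    {K : Subgroup G | IsCyclic K}.ncard + 4 = Nat.card G := by
  rcases h with ⟨⟨e⟩⟩ | ⟨⟨e⟩⟩ | ⟨⟨e⟩⟩ | ⟨⟨e⟩⟩ | ⟨⟨e⟩⟩ | ⟨⟨e⟩⟩ | ⟨⟨e⟩⟩ | ⟨⟨e⟩⟩ | ⟨⟨e⟩⟩ | ⟨⟨e⟩⟩ | ⟨⟨e⟩⟩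
  · exact ncard_isCyclic_of_mulEquiv e (by decide +kernel) (by decide +kernel)
  · exact ncard_isCyclic_of_mulEquiv e (by decide +kernel) (by decide +kernel)
  · exact ncard_isCyclic_of_mulEquiv e (by decide +kernel) (by decide +kernel)
  · exact ncard_isCyclic_of_mulEquiv e (by decide +kernel) (by decide +kernel)
  · exact ncard_isCyclic_of_mulEquiv e (by decide +kernel) (by decide +kernel)
  · exact ncard_isCyclic_of_mulEquiv e (by decide +kernel) (by decide +kernel)
  · exact ncard_isCyclic_of_mulEquiv e (by decide +kernel) (by decide +kernel)
  · exact ncard_isCyclic_of_mulEquiv e (by decide +kernel) (by decide +kernel)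
  · exact ncard_isCyclic_of_mulEquiv e (by decide +kernel) (by decide +kernel)
  · refine ncard_isCyclic_of_mulEquiv_of_orderOf_eq_eight e (Multiplicative.ofAdd 1)
      (by rw [orderOf_ofAdd_eq_addOrderOf, ZMod.addOrderOf_one]) fun g hg => absurd ?_ hg
    refine ⟨(g.toAdd).val, ?_⟩
    change Multiplicative.ofAdd 1 ^ ((g.toAdd.val : ℕ) : ℤ) = g
    rw [zpow_natCast, ← ofAdd_nsmul, nsmul_one, ZMod.natCast_zmod_val]
    rfl
  · refine ncard_isCyclic_of_mulEquiv_of_orderOf_eq_eight e (DihedralGroup.r 1)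
      DihedralGroup.orderOf_r_one ?_
    rintro (i | i) hi
    · exact absurd ⟨i.val, by simp⟩ hi
    · exact DihedralGroup.sr_mul_self i

end Examples

/-! ### Groups with an element of order eight -/

section OrderEight

variable {G : Type*} [Group G]

lemma nonempty_mulEquiv_of_orderOf_eq_eight [Finite G] {x : G} (hx : orderOf x = 8)
    (h : ∀ g ∉ Subgroup.zpowers x, g ^ 2 = 1) :
    Nonempty (G ≃* Cyc 8) ∨ Nonempty (G ≃* DihedralGroup 8) := by
  have hx8 : x ^ 8 = 1 := by rw [← hx, pow_orderOf_eq_one]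
  by_cases htop : ∀ g, g ∈ Subgroup.zpowers x
  · left
    refine nonempty_mulEquiv_of_injective (cycHom 8 x hx8) (cycHom_injective hx8 hx) ?_
    rw [← orderOf_eq_card_of_forall_mem_zpowers htop, hx]
    simp
  · right
    push Not at htop
    obtain ⟨s, hs⟩ := htop
    have hxm := Subgroup.mem_zpowers x
    have hinv : ∀ g ∉ Subgroup.zpowers x, g * x = x⁻¹ * g := by
      intro g hg
      have h1 := h g hg
      have h2 := h (g * x) fun hm => hg ((Subgroup.mul_mem_cancel_right _ hxm).1 hm)
      rw [sq] at h1 h2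
      rw [eq_inv_mul_iff_mul_eq, ← mul_left_cancel_iff (a := g), h1]
      simpa only [mul_assoc] using h2
    have hss : s * s = 1 := by rw [← sq, h s hs]
    have hsx := hinv s hs
    refine nonempty_mulEquiv_of_injective (dihedralHom 8 x s hx8 hss hsx)
      (dihedralHom_injective hx8 hss hsx hx hs) ?_
    -- A product of two elements outside `⟨x⟩` centralizes `x`; were it also outside, it would
    -- invert `x`, forcing `x ^ 2 = 1`.
    have hidx : (Subgroup.zpowers x).index = 2 := by
      rw [Subgroup.index_eq_two_iff]
      refine ⟨s, fun b => ?_⟩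
      by_cases hb : b ∈ Subgroup.zpowers x
      · exact Or.inr ⟨hb, fun hm => hs ((Subgroup.mul_mem_cancel_left _ hb).1 hm)⟩
      · refine Or.inl ⟨?_, hb⟩
        by_contra hm
        have h1 := hinv _ hm
        have h2 : b * s * x = x * (b * s) := by
          rw [mul_assoc, hsx, ← mul_assoc, ← mul_assoc]
          congr 1
          rw [mul_inv_eq_iff_eq_mul, mul_assoc, hinv b hb, mul_inv_cancel_left]
        rw [h1, mul_left_inj] at h2
        have : orderOf x ∣ 2 := orderOf_dvd_of_pow_eq_one
          (by rw [sq]; nth_rewrite 1 [← h2]; simp)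
        rw [hx] at this
        omega
    rw [← (Subgroup.zpowers x).card_mul_index, hidx, Nat.card_zpowers, hx, DihedralGroup.nat_card]

lemma ncard_sqNeOne_eq_eight_or_orderOf_eq_eight [Finite G]
    (h : {H : Subgroup G | IsCyclic H}.ncard + 4 = Nat.card G) :
    ((∀ g : G, g ^ 4 = 1 ∨ g ^ 6 = 1) ∧ (sqNeOne G).ncard = 8) ∨
      Nonempty (G ≃* Cyc 8) ∨ Nonempty (G ≃* DihedralGroup 8) := by
  have := Fintype.ofFinite G
  rw [ncard_isCyclic_add_four_eq_iff] at h
  by_cases h8 : ∃ x : G, orderOf x = 8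
  · obtain ⟨x, hx⟩ := h8
    exact Or.inr (nonempty_mulEquiv_of_orderOf_eq_eight hx
      ((sum_cyclicWeight_eq_four_iff_of_orderOf_eq_eight hx).1 h))
  · left
    push Not at h8
    have h1 : ∀ g : G, g ^ 4 = 1 ∨ g ^ 6 = 1 := by
      intro g
      rcases orderOf_cases h g with h2 | h2 | h2
      · exact h2
      · exact absurd h2 (orderOf_ne_five h g)
      · exact absurd h2 (h8 g)
    refine ⟨h1, ?_⟩
    rw [sum_cyclicWeight_of_totient_le fun g => totient_orderOf_of_pow_eq_one (h1 g)] at h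
    have : ((sqNeOne G).ncard : ℚ) = 8 := by linarith
    exact_mod_cast this

end OrderEight

/-! ### Counting elements of square one, and the possible group orders -/

section Counting

variable {G : Type*} [Group G]

/-- Each of `t` and `g * t` lies in `sqNeOne G` for exactly `(sqNeOne G).ncard` values of `t`. -/
lemma card_le_ncard_add_ncard_sqNeOne [Finite G] (g : G) :
    Nat.card G ≤ {t : G | t ^ 2 = 1 ∧ (g * t) ^ 2 = 1}.ncard + 2 * (sqNeOne G).ncard := by
  have h1 : (Set.univ : Set G) ⊆
      {t : G | t ^ 2 = 1 ∧ (g * t) ^ 2 = 1} ∪ (sqNeOne G ∪ (g⁻¹ * ·) '' sqNeOne G) := by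
    intro t _
    by_cases ht : t ^ 2 = 1
    · by_cases hg : (g * t) ^ 2 = 1
      · exact Or.inl ⟨ht, hg⟩
      · exact Or.inr (Or.inr ⟨g * t, hg, by simp⟩)
    · exact Or.inr (Or.inl ht)
  have h2 := Set.ncard_le_ncard h1 (Set.toFinite _)
  rw [Set.ncard_univ] at h2
  have h3 := Set.ncard_union_le {t : G | t ^ 2 = 1 ∧ (g * t) ^ 2 = 1}
    (sqNeOne G ∪ (g⁻¹ * ·) '' sqNeOne G)
  have h4 := Set.ncard_union_le (sqNeOne G) ((g⁻¹ * ·) '' sqNeOne G)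
  rw [Set.ncard_image_of_injective _ (mul_right_injective _)] at h4
  omega

lemma mul_eq_inv_mul_of_sq_eq_one {g t : G} (h1 : t ^ 2 = 1) (h2 : (g * t) ^ 2 = 1) :
    t * g = g⁻¹ * t := by
  rw [sq] at h1 h2
  rw [eq_inv_mul_iff_mul_eq, ← mul_left_inj t, h1]
  simpa only [mul_assoc] using h2

lemma Subgroup.eq_top_of_card_lt_two_mul [Finite G] {H : Subgroup G}
    (h : Nat.card G < 2 * Nat.card H) : H = ⊤ := by
  have h1 := H.card_mul_index
  have h2 : H.index < 2 := by
    by_contra! h3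
    have := Nat.mul_le_mul_left (Nat.card H) h3
    omega
  have h3 := H.index_ne_zero_of_finite
  exact Subgroup.index_eq_one.1 (by omega)

lemma ncard_sqNeOne_add_ncard (G : Type*) [Group G] [Finite G] :
    {g : G | g ^ 2 = 1}.ncard + (sqNeOne G).ncard = Nat.card G :=
  Set.ncard_add_ncard_compl {g : G | g ^ 2 = 1}

/-- If `g ^ 2 = 1`, inverting `g` is the same as commuting with it, so the centralizer of `g` has
more than half of the elements and `g` is central. Such `g` make up more than half of `G`, so `G` is
abelian, and any `t` with `t ^ 2 = (g * t) ^ 2 = 1` yields `g ^ 2 = 1`. -/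
lemma sq_eq_one_of_four_mul_ncard_lt [Finite G] (h : 4 * (sqNeOne G).ncard < Nat.card G) (g : G) :
    g ^ 2 = 1 := by
  have hc : ∀ g : G, g ^ 2 = 1 → g ∈ Subgroup.center G := by
    intro g hg
    have h1 : Subgroup.centralizer {g} = ⊤ := by
      apply Subgroup.eq_top_of_card_lt_two_mul
      have h2 := card_le_ncard_add_ncard_sqNeOne g
      have h3 : {t : G | t ^ 2 = 1 ∧ (g * t) ^ 2 = 1}.ncard ≤
          Nat.card (Subgroup.centralizer {g}) := by
        rw [← SetLike.coe_sort_coe, Nat.card_coe_set_eq]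
        refine Set.ncard_le_ncard (fun t ht => ?_) (Set.toFinite _)
        rw [SetLike.mem_coe, Subgroup.mem_centralizer_singleton_iff]
        rw [mul_eq_inv_mul_of_sq_eq_one ht.1 ht.2, inv_eq_of_mul_eq_one_left (a := g)]
        rwa [← sq]
      omega
    rw [Subgroup.mem_center_iff]
    intro k
    have : k ∈ Subgroup.centralizer {g} := h1 ▸ Subgroup.mem_top k
    exact Subgroup.mem_centralizer_singleton_iff.1 this
  have h1 : Subgroup.center G = ⊤ := by
    apply Subgroup.eq_top_of_card_lt_two_mul
    have h2 : {g : G | g ^ 2 = 1}.ncard ≤ Nat.card (Subgroup.center G) := by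
      rw [← SetLike.coe_sort_coe, Nat.card_coe_set_eq]
      exact Set.ncard_le_ncard hc (Set.toFinite _)
    have h3 := ncard_sqNeOne_add_ncard G
    omega
  have h2 := card_le_ncard_add_ncard_sqNeOne g
  obtain ⟨t, ht⟩ : {t : G | t ^ 2 = 1 ∧ (g * t) ^ 2 = 1}.Nonempty := by
    rw [← Set.ncard_pos]
    omega
  have h3 : g ∈ Subgroup.center G := h1 ▸ Subgroup.mem_top g
  have h4 : Commute g t := ((Subgroup.mem_center_iff.1 h3) t).symm
  simpa [h4.mul_pow, ht.1] using ht.2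

lemma card_cases [Finite G] (h : ∀ g : G, g ^ 4 = 1 ∨ g ^ 6 = 1) (h8 : (sqNeOne G).ncard = 8) :
    Nat.card G = 9 ∨ Nat.card G = 12 ∨ Nat.card G = 16 ∨ Nat.card G = 18 ∨ Nat.card G = 24 ∨
      Nat.card G = 32 := by
  have h1 : Nat.card G ≤ 32 := by
    by_contra! h2
    have h3 := sq_eq_one_of_four_mul_ncard_lt (G := G) (by omega)
    have h4 : sqNeOne G = ∅ := Set.eq_empty_of_forall_notMem fun g hg => hg (h3 g)
    simp [h4] at h8
  have h2 : 9 ≤ Nat.card G := by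
    have h3 := ncard_sqNeOne_add_ncard G
    have : 0 < {g : G | g ^ 2 = 1}.ncard := (Set.ncard_pos).2 ⟨1, one_pow 2⟩
    omega
  have hp : ∀ p : ℕ, p.Prime → 3 < p → ¬ p ∣ Nat.card G := by
    intro p hp hp3 hdvd
    have := Fact.mk hp
    obtain ⟨x, hx⟩ := exists_prime_orderOf_dvd_card' p hdvd
    have h4 : p ∣ 4 ∨ p ∣ 6 := by
      rw [← hx]
      exact (h x).imp orderOf_dvd_of_pow_eq_one orderOf_dvd_of_pow_eq_one
    have h5 : p ≤ 6 := by
      rcases h4 with h4 | h4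
      · exact (Nat.le_of_dvd (by norm_num) h4).trans (by norm_num)
      · exact Nat.le_of_dvd (by norm_num) h4
    interval_cases p <;> first | omega | exact absurd hp (by norm_num)
  -- In odd order only `1` has square `1`, but `27 - 8 = 19` such elements would be needed.
  have h27 : Nat.card G ≠ 27 := by
    intro h27
    have h3 := ncard_sqNeOne_add_ncard G
    have h4 : {g : G | g ^ 2 = 1} ⊆ {1} := by
      intro g hg
      have h5 := orderOf_dvd_of_pow_eq_one hg
      have h6 := orderOf_dvd_natCard g
      rw [h27] at h6
      have h7 := Nat.dvd_gcd h5 h6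
      exact orderOf_eq_one_iff.1 (Nat.dvd_one.1 h7)
    have h5 := Set.ncard_le_ncard h4
    rw [Set.ncard_singleton] at h5
    omega
  have h5 := hp 5 (by norm_num) (by norm_num)
  have h7 := hp 7 (by norm_num) (by norm_num)
  have h11 := hp 11 (by norm_num) (by norm_num)
  have h13 := hp 13 (by norm_num) (by norm_num)
  have h17 := hp 17 (by norm_num) (by norm_num)
  have h19 := hp 19 (by norm_num) (by norm_num)
  have h23 := hp 23 (by norm_num) (by norm_num)
  have h29 := hp 29 (by norm_num) (by norm_num)
  have h31 := hp 31 (by norm_num) (by norm_num)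
  omega

/-- The elements of square `1` in a commutative subgroup. -/
def sqOneSubgroup (A : Subgroup G) (hA : ∀ a ∈ A, ∀ b ∈ A, a * b = b * a) : Subgroup G where
  carrier := {g | g ∈ A ∧ g ^ 2 = 1}
  one_mem' := ⟨A.one_mem, one_pow 2⟩
  mul_mem' := fun {a b} ha hb =>
    ⟨A.mul_mem ha.1 hb.1, by
      rw [(show Commute a b from hA a ha.1 b hb.1).mul_pow, ha.2, hb.2, one_mul]⟩
  inv_mem' := fun {a} ha => ⟨A.inv_mem ha.1, by rw [inv_pow, ha.2, inv_one]⟩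

lemma commute_of_sq_eq_one {s t : G} (hs : s ^ 2 = 1) (ht : t ^ 2 = 1) (hst : (s * t) ^ 2 = 1) :
    s * t = t * s := by
  rw [sq] at *
  rw [← inv_eq_of_mul_eq_one_left hst, mul_inv_rev, inv_eq_of_mul_eq_one_left hs,
    inv_eq_of_mul_eq_one_left ht]

/-- If all elements outside a subgroup have square `1`, they invert the subgroup. -/
lemma mul_eq_inv_mul_of_notMem {A : Subgroup G} (hA : ∀ g ∉ A, g ^ 2 = 1) {s a : G} (hs : s ∉ A)
    (ha : a ∈ A) : s * a = a⁻¹ * s :=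
  mul_eq_inv_mul_of_sq_eq_one (hA s hs)
    (hA _ fun hm => hs ((Subgroup.mul_mem_cancel_left _ ha).1 hm))

lemma mul_comm_of_forall_notMem_sq {A : Subgroup G} (hA : ∀ g ∉ A, g ^ 2 = 1) {s : G}
    (hs : s ∉ A) {a b : G} (ha : a ∈ A) (hb : b ∈ A) : a * b = b * a := by
  have h1 := mul_eq_inv_mul_of_notMem hA hs (A.mul_mem ha hb)
  rw [← mul_assoc, mul_eq_inv_mul_of_notMem hA hs ha, mul_assoc,
    mul_eq_inv_mul_of_notMem hA hs hb, ← mul_assoc, mul_left_inj, ← mul_inv_rev, inv_inj] at h1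
  exact h1.symm

lemma ncard_compl_subgroup_of_index_eq_two [Finite G] {A : Subgroup G}
    (h : 2 * Nat.card A = Nat.card G) : ((A : Set G)ᶜ).ncard = Nat.card A := by
  have h1 := Set.ncard_add_ncard_compl (A : Set G)
  have h2 : (A : Set G).ncard = Nat.card A := (Nat.card_coe_set_eq _).symm
  omega

lemma ncard_inter_add_ncard_diff_sqOne [Finite G] (A : Subgroup G) :
    {g : G | g ∈ A ∧ g ^ 2 = 1}.ncard + {g : G | g ∉ A ∧ g ^ 2 = 1}.ncard =
      {g : G | g ^ 2 = 1}.ncard := by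
  rw [← Set.ncard_inter_add_ncard_sdiff_eq_ncard {g : G | g ^ 2 = 1} (A : Set G)]
  congr 2 <;> ext g <;> simp [and_comm]

/-- The elements counted all invert `g`, and the product of two elements inverting `g` centralizes
it. -/
lemma ncard_le_card_centralizer [Finite G] (g : G) :
    {t : G | t ^ 2 = 1 ∧ (g * t) ^ 2 = 1}.ncard ≤ Nat.card (Subgroup.centralizer {g}) := by
  rcases Set.eq_empty_or_nonempty {t : G | t ^ 2 = 1 ∧ (g * t) ^ 2 = 1} with h | ⟨u, hu⟩
  · simp [h]
  · rw [← SetLike.coe_sort_coe, Nat.card_coe_set_eq]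
    refine Set.ncard_le_ncard_of_injOn (u * ·) (fun t ht => ?_) (mul_right_injective u).injOn
      (Set.toFinite _)
    rw [SetLike.mem_coe, Subgroup.mem_centralizer_singleton_iff]
    have h1 := mul_eq_inv_mul_of_sq_eq_one hu.1 hu.2
    have h2 := mul_eq_inv_mul_of_sq_eq_one ht.1 ht.2
    rw [mul_assoc, h2, ← mul_assoc, ← mul_assoc]
    congr 1
    rw [mul_inv_eq_iff_eq_mul, mul_assoc, h1, mul_inv_cancel_left]

lemma notMem_centralizer_of_inverts {g t : G} (hg : g ^ 2 ≠ 1) (h1 : t ^ 2 = 1)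
    (h2 : (g * t) ^ 2 = 1) : t ∉ Subgroup.centralizer {g} := by
  rw [Subgroup.mem_centralizer_singleton_iff, mul_eq_inv_mul_of_sq_eq_one h1 h2, mul_left_inj]
  exact fun h => hg (by rw [sq]; nth_rewrite 1 [← h]; simp)

/-- The products `x ^ i * s`, with `s ^ 2 = 1` in the centralizer and `i < 3`, are distinct:
squaring gives `x ^ (2 * i)`, which recovers `i`. -/
lemma three_mul_ncard_le_card_centralizer [Finite G] {x : G} (hx : orderOf x = 3) :
    3 * {g : G | g ∈ Subgroup.centralizer {x} ∧ g ^ 2 = 1}.ncard ≤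
      Nat.card (Subgroup.centralizer {x}) := by
  have h1 : ((Set.univ : Set (Fin 3)) ×ˢ
      {g : G | g ∈ Subgroup.centralizer {x} ∧ g ^ 2 = 1}).ncard =
      3 * {g : G | g ∈ Subgroup.centralizer {x} ∧ g ^ 2 = 1}.ncard := by
    rw [Set.ncard_prod, Set.ncard_univ]
    simp
  rw [← h1, ← SetLike.coe_sort_coe (Subgroup.centralizer {x}), Nat.card_coe_set_eq]
  have hxm : x ∈ Subgroup.centralizer {x} := Subgroup.mem_centralizer_singleton_iff.2 rfl
  refine Set.ncard_le_ncard_of_injOn (fun p => x ^ (p.1 : ℕ) * p.2)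
    (fun p hp => mul_mem (pow_mem hxm _) hp.2.1) ?_ (Set.toFinite _)
  rintro ⟨i, s⟩ ⟨-, hs⟩ ⟨j, t⟩ ⟨-, ht⟩ hij
  simp only at hs ht hij
  have cs : Commute x s := (Subgroup.mem_centralizer_singleton_iff.1 hs.1).symm
  have ct : Commute x t := (Subgroup.mem_centralizer_singleton_iff.1 ht.1).symm
  have h2 := congrArg (· ^ 2) hij
  simp only [(cs.pow_left i).mul_pow, (ct.pow_left j).mul_pow, hs.2, ht.2, mul_one,
    ← pow_mul] at h2
  have h3 := pow_eq_pow_iff_modEq.1 h2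
  rw [hx] at h3
  have h4 : (i : ℕ) * 2 % 3 = j * 2 % 3 := h3
  have h5 : i = j := by omega
  subst h5
  simpa using hij

end Counting

/-! ### Building direct and semidirect products inside a group -/

section Extensions

variable {G H : Type*} [Group G] [Group H]

/-- Adjoining a commuting element to the range of an injective homomorphism. -/
lemma noncommCoprod_cycHom_injective {p : ℕ} [Fact p.Prime] (y : G) (hy : y ^ p = 1)
    (f : H →* G) (hf : Function.Injective f) (hmem : y ∉ f.range)
    (hcomm : ∀ m n, Commute (cycHom p y hy m) (f n)) :
    Function.Injective (MonoidHom.noncommCoprod (cycHom p y hy) f hcomm) := by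
  have hy1 : y ≠ 1 := fun h => hmem (h ▸ one_mem _)
  rw [MonoidHom.noncommCoprod_injective]
  refine ⟨cycHom_injective hy (orderOf_eq_prime hy hy1), hf, ?_⟩
  rw [disjoint_iff, Subgroup.eq_bot_iff_forall]
  rintro _ ⟨⟨a, rfl⟩, ha⟩
  obtain ⟨k, -, hk⟩ := exists_cycHom_eq_zpow hy a
  rw [hk] at ha ⊢
  by_contra hne
  refine hmem ?_
  have hpk : ¬ (p : ℤ) ∣ k := by
    rintro ⟨m, rfl⟩
    exact hne (by rw [zpow_mul, zpow_natCast, hy, one_zpow])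
  have hg : Int.gcd p k = 1 := by
    rw [← Int.isCoprime_iff_gcd_eq_one]
    exact (Nat.prime_iff_prime_int.1 (Fact.out : p.Prime)).coprime_iff_not_dvd.2 hpk
  -- By Bézout, `y` is a power of `y ^ k`, hence would lie in the range of `f`.
  have hb := Int.gcd_eq_gcd_ab p k
  rw [hg] at hb
  have : y = (y ^ k) ^ (Int.gcdB p k) := by
    conv_lhs => rw [← zpow_one y, ← Nat.cast_one, hb, zpow_add, zpow_mul, zpow_natCast, hy,
      one_zpow, one_mul, zpow_mul]
  rw [this]
  exact zpow_mem (show y ^ k ∈ f.range from ha) _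

lemma commute_cycHom {p : ℕ} {y g : G} (hy : y ^ p = 1) (h : Commute y g) (a : Cyc p) :
    Commute (cycHom p y hy a) g := by
  obtain ⟨k, -, hk⟩ := exists_cycHom_eq_zpow hy a
  rw [hk]
  exact h.zpow_left k

/-- Adjoins some `y ∈ E` outside the range. The bound on the new intersection with `E` lets the step
be iterated: that intersection is covered by the old one and its translate by `y`. -/
lemma exists_injective_cyc_two_prod [Finite G] (f : H →* G) (hf : Function.Injective f)
    (E : Subgroup G) (hE : ∀ e ∈ E, e ^ 2 = 1) (hcomm : ∀ e ∈ E, ∀ h, Commute e (f h))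
    (hcard : Nat.card (E ⊓ f.range : Subgroup G) < Nat.card E) :
    ∃ f' : Cyc 2 × H →* G, Function.Injective f' ∧ (∀ e ∈ E, ∀ h, Commute e (f' h)) ∧
      Nat.card (E ⊓ f'.range : Subgroup G) ≤ 2 * Nat.card (E ⊓ f.range : Subgroup G) := by
  obtain ⟨y, hyE, hyf⟩ : ∃ y ∈ E, y ∉ f.range := by
    by_contra! hcon
    rw [inf_eq_left.2 hcon] at hcard
    exact lt_irrefl _ hcard
  have hy := hE y hyE
  have hc : ∀ m n, Commute (cycHom 2 y hy m) (f n) :=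
    fun m n => commute_cycHom hy (hcomm y hyE n) m
  have hEc : ∀ a ∈ E, ∀ b ∈ E, a * b = b * a := fun a ha b hb =>
    commute_of_sq_eq_one (hE a ha) (hE b hb) (hE _ (mul_mem ha hb))
  refine ⟨MonoidHom.noncommCoprod (cycHom 2 y hy) f hc,
    noncommCoprod_cycHom_injective y hy f hf hyf hc, ?_, ?_⟩
  · rintro e he ⟨m, n⟩
    rw [MonoidHom.noncommCoprod_apply]
    exact ((commute_cycHom hy (hEc y hyE e he) m).symm).mul_right (hcomm e he n)
  · have hcyc : ∀ m : Cyc 2, m = 1 ∨ m = Multiplicative.ofAdd 1 := by decide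
    have hsub : ((E ⊓ (MonoidHom.noncommCoprod (cycHom 2 y hy) f hc).range : Subgroup G) : Set G) ⊆
        ((E ⊓ f.range : Subgroup G) : Set G) ∪ (y * ·) '' ((E ⊓ f.range : Subgroup G) : Set G) := by
      rintro _ ⟨he, ⟨m, n⟩, rfl⟩
      rw [MonoidHom.noncommCoprod_apply] at he ⊢
      rcases hcyc m with rfl | rfl
      · left
        rw [map_one, one_mul] at he ⊢
        exact ⟨he, n, rfl⟩
      · right
        simp only [cycHom_one] at he ⊢
        exact ⟨f n, ⟨(Subgroup.mul_mem_cancel_left _ hyE).1 he, n, rfl⟩, rfl⟩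
    have h1 := Set.ncard_le_ncard hsub (Set.toFinite _)
    have h2 := Set.ncard_union_le ((E ⊓ f.range : Subgroup G) : Set G)
      ((y * ·) '' ((E ⊓ f.range : Subgroup G) : Set G))
    rw [Set.ncard_image_of_injective _ (mul_right_injective y)] at h2
    simp only [← SetLike.coe_sort_coe, Nat.card_coe_set_eq]
    omega

lemma nonempty_mulEquiv_cyc_two_prod_cyc_two_prod [Finite G] (f : H →* G)
    (hf : Function.Injective f) (E : Subgroup G) (hE : ∀ e ∈ E, e ^ 2 = 1)
    (hcomm : ∀ e ∈ E, ∀ h, Commute e (f h))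
    (hcard : 2 * Nat.card (E ⊓ f.range : Subgroup G) < Nat.card E)
    (hG : Nat.card G = 4 * Nat.card H) : Nonempty (G ≃* Cyc 2 × Cyc 2 × H) := by
  obtain ⟨f1, hf1, hc1, hcard1⟩ := exists_injective_cyc_two_prod f hf E hE hcomm (by omega)
  obtain ⟨f2, hf2, -⟩ := exists_injective_cyc_two_prod f1 hf1 E hE hc1 (by omega)
  refine nonempty_mulEquiv_of_injective f2 hf2 ?_
  rw [Nat.card_prod, Nat.card_prod, hG]
  simp
  ring

lemma SemidirectProduct.lift_injective_of_disjoint {N K : Type*} [Group N] [Group K]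
    {φ : K →* MulAut N} (f : N →* G) (g : K →* G)
    (h : ∀ k, f.comp (φ k).toMonoidHom = (MulAut.conj (g k)).toMonoidHom.comp f)
    (hf : Function.Injective f) (hg : Function.Injective g) (hd : Disjoint f.range g.range) :
    Function.Injective (SemidirectProduct.lift f g h) := by
  rw [injective_iff_map_eq_one]
  rintro ⟨n, k⟩ hnk
  have h1 : f n * g k = 1 := hnk
  have h2 : f n = 1 := by
    refine Subgroup.disjoint_def.1 hd ⟨n, rfl⟩ ⟨k⁻¹, ?_⟩
    rw [map_inv, eq_inv_of_mul_eq_one_left h1]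
  rw [h2, one_mul] at h1
  rw [(map_eq_one_iff f hf).1 h2, (map_eq_one_iff g hg).1 h1]
  rfl

/-- Compatibility with a cyclic action need only be checked on the generator; induction on the
integer exponent in both directions does the rest. -/
lemma semidirect_compat_of_generator {N : Type*} [Group N] {n : ℕ} {φ : Cyc n →* MulAut N}
    (f : N →* G) (c : G) (hc : c ^ n = 1)
    (h : ∀ m, f (φ (Multiplicative.ofAdd 1) m) = c * f m * c⁻¹) (k : Cyc n) :
    f.comp (φ k).toMonoidHom =
      (MulAut.conj (cycHom n c hc k)).toMonoidHom.comp f := by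
  have hinv : ∀ m, f (φ (Multiplicative.ofAdd 1)⁻¹ m) = c⁻¹ * f m * c := by
    intro m
    have := h (φ (Multiplicative.ofAdd 1)⁻¹ m)
    rw [map_inv, MulAut.apply_inv_self] at this
    rw [this, map_inv]
    group
  obtain ⟨k, rfl, hk⟩ := exists_cycHom_eq_zpow hc k
  ext m
  have hk' : (Multiplicative.ofAdd (k : ZMod n) : Cyc n) = (Multiplicative.ofAdd 1) ^ k := by
    rw [← ofAdd_zsmul, zsmul_one]
  rw [hk, hk']
  simp only [MonoidHom.coe_comp, MulEquiv.toMonoidHom_eq_coe, MonoidHom.coe_coe,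
    Function.comp_apply, MulAut.conj_apply]
  clear hk hk'
  induction k generalizing m with
  | zero => simp
  | succ i ih =>
    rw [zpow_add_one, map_mul, MulAut.mul_apply, ih, h, zpow_add_one]
    group
  | pred i ih =>
    rw [zpow_sub_one, map_mul, MulAut.mul_apply, ih, hinv, zpow_sub_one]
    group

end Extensions

/-! ### Orders nine and eighteen -/

section NineEighteen

variable {G : Type*} [Group G]

lemma exists_injective_cyc_three_prod [Finite G] {P : Subgroup G} (hP : Nat.card P = 9)
    (hcomm : ∀ a ∈ P, ∀ b ∈ P, a * b = b * a) (h3 : ∀ a ∈ P, a ^ 3 = 1) :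
    ∃ f : Cyc 3 × Cyc 3 →* G, Function.Injective f ∧ ∀ m, f m ∈ P := by
  obtain ⟨x, hxP, hx1⟩ : ∃ x ∈ P, x ≠ 1 := by
    by_contra! hcon
    rw [(Subgroup.eq_bot_iff_forall P).2 hcon, Subgroup.card_bot] at hP
    omega
  have hx3 := h3 x hxP
  have hox : orderOf x = 3 := orderOf_eq_prime hx3 hx1
  obtain ⟨y, hyP, hyx⟩ : ∃ y ∈ P, y ∉ Subgroup.zpowers x := by
    by_contra! hcon
    have := Subgroup.card_le_of_le hcon
    rw [hP, Nat.card_zpowers, hox] at this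
    omega
  have hy3 := h3 y hyP
  have hz : ∀ n, cycHom 3 x hx3 n ∈ Subgroup.zpowers x := cycHom_mem_zpowers hx3
  have hz' : ∀ n, cycHom 3 y hy3 n ∈ Subgroup.zpowers y := cycHom_mem_zpowers hy3
  have hxle : Subgroup.zpowers x ≤ P := by simpa using hxP
  have hyle : Subgroup.zpowers y ≤ P := by simpa using hyP
  have hc : ∀ m n, Commute (cycHom 3 y hy3 m) (cycHom 3 x hx3 n) :=
    fun m n => hcomm _ (hyle (hz' m)) _ (hxle (hz n))
  refine ⟨MonoidHom.noncommCoprod (cycHom 3 y hy3) (cycHom 3 x hx3) hc,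
    noncommCoprod_cycHom_injective y hy3 _ (cycHom_injective hx3 hox) ?_ hc, ?_⟩
  · rintro ⟨m, rfl⟩
    exact hyx (hz m)
  · rintro ⟨m, n⟩
    rw [MonoidHom.noncommCoprod_apply]
    exact mul_mem (hyle (hz' m)) (hxle (hz n))

lemma nonempty_mulEquiv_of_card_eq_nine [Finite G] (h : ∀ g : G, g ^ 4 = 1 ∨ g ^ 6 = 1)
    (hcard : Nat.card G = 9) : Nonempty (G ≃* Cyc 3 × Cyc 3) := by
  have : Fact (Nat.Prime 3) := ⟨Nat.prime_three⟩
  have hcomm : ∀ a b : G, a * b = b * a :=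
    (IsPGroup.isMulCommutative_of_card_eq_prime_sq (p := 3)
      (by rw [hcard]; norm_num)).is_comm.comm
  obtain ⟨f, hf, -⟩ := exists_injective_cyc_three_prod (P := (⊤ : Subgroup G))
    (by rw [Subgroup.card_top, hcard]) (fun a _ b _ => hcomm a b) (fun a _ => by
      have h9 : a ^ 9 = 1 := by rw [← hcard, pow_card_eq_one']
      rcases h a with h | h
      · have : a ^ Nat.gcd 4 9 = 1 := pow_gcd_eq_one.2 ⟨h, h9⟩
        have h1 : a = 1 := by simpa using this
        rw [h1, one_pow]
      · exact pow_gcd_eq_one.2 ⟨h, h9⟩)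
  exact nonempty_mulEquiv_of_injective f hf (by rw [hcard]; simp)

/-- The eight nontrivial elements of a subgroup of order `9` exhaust `sqNeOne G`, so all other
elements have square `1` and invert that subgroup. -/
lemma nonempty_mulEquiv_of_card_eq_eighteen [Finite G] (h : ∀ g : G, g ^ 4 = 1 ∨ g ^ 6 = 1)
    (h8 : (sqNeOne G).ncard = 8) (hcard : Nat.card G = 18) :
    Nonempty (G ≃* (Cyc 3 × Cyc 3) ⋊[invAction] Cyc 2) := by
  have : Fact (Nat.Prime 3) := ⟨Nat.prime_three⟩
  obtain ⟨P, hP⟩ := Sylow.exists_subgroup_card_pow_prime (G := G) 3 (n := 2)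
    (by rw [hcard]; norm_num)
  norm_num at hP
  have h9 : ∀ a ∈ P, a ^ 9 = 1 := fun a ha => by
    have := pow_card_eq_one' (x := (⟨a, ha⟩ : P))
    rw [hP] at this
    simpa using congrArg Subtype.val this
  have h3 : ∀ a ∈ P, a ^ 3 = 1 := by
    intro a ha
    rcases h a with h | h
    · have : a ^ Nat.gcd 4 9 = 1 := pow_gcd_eq_one.2 ⟨h, h9 a ha⟩
      have h1 : a = 1 := by simpa using this
      rw [h1, one_pow]
    · exact pow_gcd_eq_one.2 ⟨h, h9 a ha⟩
  have hsub : (P : Set G) \ {1} ⊆ sqNeOne G := by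
    rintro a ⟨ha, ha1⟩ ha2
    have : a ^ Nat.gcd 2 3 = 1 := pow_gcd_eq_one.2 ⟨ha2, h3 a ha⟩
    exact ha1 (by simpa using this)
  have hPn : (P : Set G).ncard = 9 := by rw [← Nat.card_coe_set_eq]; exact hP
  have heq : (P : Set G) \ {1} = sqNeOne G := by
    refine Set.eq_of_subset_of_ncard_le hsub ?_ (Set.toFinite _)
    rw [Set.ncard_sdiff_singleton_of_mem P.one_mem, hPn, h8]
  have hout : ∀ g ∉ P, g ^ 2 = 1 := by
    intro g hg
    by_contra h2
    have : g ∈ (P : Set G) \ {1} := heq ▸ h2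
    exact hg this.1
  obtain ⟨s, hs⟩ : ∃ s, s ∉ P := by
    by_contra! hcon
    rw [(Subgroup.eq_top_iff' P).2 hcon, Subgroup.card_top, hcard] at hP
    omega
  have hs2 := hout s hs
  obtain ⟨f, hf, hfP⟩ := exists_injective_cyc_three_prod hP
    (fun a ha b hb => mul_comm_of_forall_notMem_sq hout hs ha hb) h3
  refine nonempty_mulEquiv_of_injective _
    (SemidirectProduct.lift_injective_of_disjoint f (cycHom 2 s hs2)
    (semidirect_compat_of_generator f s hs2 fun m => ?_) hf
    (cycHom_injective hs2 (orderOf_eq_prime hs2 fun h1 => hs (h1 ▸ P.one_mem))) ?_) ?_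
  · have h1 : invAction (Multiplicative.ofAdd 1) = MulEquiv.inv _ := by
      change (if (Multiplicative.ofAdd 1 : Cyc 2) = 1 then 1 else MulEquiv.inv _) = _
      exact if_neg (by decide)
    rw [h1, MulEquiv.inv_apply, map_inv, mul_eq_inv_mul_of_notMem hout hs (hfP m)]
    simp
  · rw [Subgroup.disjoint_def]
    rintro _ ⟨m, rfl⟩ ⟨k, hk⟩
    have hcyc : ∀ m : Cyc 2, m = 1 ∨ m = Multiplicative.ofAdd 1 := by decide
    rcases hcyc k with rfl | rfl
    · rw [← hk, map_one]
    · rw [cycHom_one] at hk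
      exact absurd (hk ▸ hfP m) hs
  · rw [SemidirectProduct.card, hcard]
    simp

end NineEighteen

/-! ### Orders twenty-four and thirty-two -/

section DihedralProducts

variable {G : Type*} [Group G]

/-- Elements of `A` of square `1` commute with the dihedral group `⟨x, s⟩`, since `s` inverts and
hence fixes them. Only rotations of `⟨x, s⟩` lie in `A`, so `hE` leaves room to adjoin two factors
`C₂`. -/
lemma nonempty_mulEquiv_cyc_two_prod_cyc_two_prod_dihedral [Finite G] {n : ℕ} [NeZero n]
    {A : Subgroup G} (hA : ∀ g ∉ A, g ^ 2 = 1) {x s : G} (hx : x ∈ A) (hs : s ∉ A)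
    (ho : orderOf x = n) (hcard : Nat.card G = 8 * n)
    (hE : 2 * (Finset.univ.filter fun i : ZMod n => i + i = 0).card <
      {g : G | g ∈ A ∧ g ^ 2 = 1}.ncard) :
    Nonempty (G ≃* Cyc 2 × Cyc 2 × DihedralGroup n) := by
  have hxn : x ^ n = 1 := by rw [← ho, pow_orderOf_eq_one]
  have hss : s * s = 1 := by rw [← sq, hA s hs]
  have hsx := mul_eq_inv_mul_of_notMem hA hs hx
  have hxle : Subgroup.zpowers x ≤ A := by simpa using hx
  have hcA : ∀ a ∈ A, ∀ b ∈ A, a * b = b * a :=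
    fun a ha b hb => mul_comm_of_forall_notMem_sq hA hs ha hb
  have hinj := dihedralHom_injective hxn hss hsx ho fun hm => hs (hxle hm)
  have hmem : ∀ i, cycHom n x hxn i ∈ A := fun i => hxle (cycHom_mem_zpowers hxn i)
  refine nonempty_mulEquiv_cyc_two_prod_cyc_two_prod (dihedralHom n x s hxn hss hsx) hinj
    (sqOneSubgroup A hcA) (fun e he => he.2) ?_ ?_ ?_
  · rintro e ⟨heA, he2⟩ (i | i)
    · exact hcA e heA _ (hmem _)
    · refine Commute.mul_right ?_ (hcA e heA _ (hmem _))
      have h1 := mul_eq_inv_mul_of_notMem hA hs heA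
      rw [inv_eq_of_mul_eq_one_left (a := e) (by rw [← sq, he2])] at h1
      exact h1.symm
  · have h1 : Nat.card (sqOneSubgroup A hcA) = {g : G | g ∈ A ∧ g ^ 2 = 1}.ncard := by
      rw [← SetLike.coe_sort_coe, Nat.card_coe_set_eq]
      rfl
    rw [h1]
    refine lt_of_le_of_lt (Nat.mul_le_mul_left 2 ?_) hE
    rw [← SetLike.coe_sort_coe, Nat.card_coe_set_eq, ← Set.ncard_coe_finset]
    refine (Set.ncard_le_ncard ?_ (Set.toFinite _)).trans (Set.ncard_image_le
      (f := fun i : ZMod n => dihedralHom n x s hxn hss hsx (DihedralGroup.r i)) (Set.toFinite _))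
    rintro _ ⟨⟨hgA, hg2⟩, ⟨i | i, rfl⟩⟩
    · refine ⟨i, ?_, rfl⟩
      rw [← map_pow, map_eq_one_iff _ hinj, sq, DihedralGroup.r_mul_r, DihedralGroup.one_def,
        DihedralGroup.r.injEq] at hg2
      simpa using hg2
    · exact absurd ((Subgroup.mul_mem_cancel_right _ (hmem _)).1 hgA) hs
  · rw [hcard, DihedralGroup.nat_card]
    ring

lemma nonempty_dihedral_three_mulEquiv_perm :
    Nonempty (DihedralGroup 3 ≃* Equiv.Perm (Fin 3)) := by
  obtain ⟨e⟩ := nonempty_mulEquiv_of_injective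
    (dihedralHom 3 (finRotate 3) (Equiv.swap 0 1) (by decide) (by decide) (by decide))
    (dihedralHom_injective _ _ _ (orderOf_eq_prime (by decide) (by decide))
      (by rw [mem_zpowers_iff_mem_range_orderOf,
            orderOf_eq_prime (p := 3) (by decide) (by decide)]; decide))
    (by rw [DihedralGroup.nat_card, Nat.card_perm]; simp [Nat.factorial])
  exact ⟨e.symm⟩

lemma nonempty_mulEquiv_of_card_eq_twentyfour [Finite G]
    (h8 : (sqNeOne G).ncard = 8) (hcard : Nat.card G = 24) :
    Nonempty (G ≃* Cyc 2 × Cyc 2 × Equiv.Perm (Fin 3)) := by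
  obtain ⟨x, hx⟩ := exists_prime_orderOf_dvd_card' (G := G) 3 (hp := ⟨Nat.prime_three⟩)
    (by rw [hcard]; norm_num)
  have hx2 : x ^ 2 ≠ 1 := fun h => by
    have := orderOf_dvd_of_pow_eq_one h
    rw [hx] at this
    omega
  have h1 := card_le_ncard_add_ncard_sqNeOne x
  have h2 := ncard_le_card_centralizer x
  have h3 := three_mul_ncard_le_card_centralizer hx
  have hI := ncard_sqNeOne_add_ncard G
  set C := Subgroup.centralizer {x} with hC
  have hxC : x ∈ C := Subgroup.mem_centralizer_singleton_iff.2 rfl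
  obtain ⟨s, hs⟩ : {t : G | t ^ 2 = 1 ∧ (x * t) ^ 2 = 1}.Nonempty := by
    rw [← Set.ncard_pos]
    omega
  have hsC : s ∉ C := notMem_centralizer_of_inverts hx2 hs.1 hs.2
  -- At least `24 - 16 = 8` elements invert `x`, so `|C| ≥ 8`; also `3 ∣ |C|`, and `C ≠ G` because
  -- of `s`.
  have hcC : Nat.card C = 12 := by
    have h4 := Subgroup.card_subgroup_dvd_card C
    have h5 : 3 ∣ Nat.card C := hx ▸ Subgroup.orderOf_dvd_natCard C hxC
    have h6 : Nat.card C ≠ 24 := fun h => hsC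
      ((Subgroup.eq_top_of_card_eq C (h.trans hcard.symm)) ▸ Subgroup.mem_top s)
    rw [hcard] at h4
    have h7 := Nat.le_of_dvd (by norm_num) h4
    interval_cases Nat.card C <;> omega
  have h4 := ncard_inter_add_ncard_diff_sqOne C
  have h5 := ncard_compl_subgroup_of_index_eq_two (A := C) (by omega)
  have hsub : {g : G | g ∉ C ∧ g ^ 2 = 1} ⊆ (C : Set G)ᶜ := fun g hg => hg.1
  -- Of the `16` elements of square `1`, at most `12 / 3 = 4` lie in `C`, so the other `12` fill the
  -- complement.
  have heq := Set.eq_of_subset_of_ncard_le hsub (by omega) (Set.toFinite _)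
  have hout : ∀ g ∉ C, g ^ 2 = 1 := by
    intro g hg
    have : g ∈ (C : Set G)ᶜ := hg
    rw [← heq] at this
    exact this.2
  rw [heq, h5] at h4
  obtain ⟨e⟩ := nonempty_mulEquiv_cyc_two_prod_cyc_two_prod_dihedral hout hxC hsC hx
    (by rw [hcard]) (by
      rw [show (Finset.univ.filter fun i : ZMod 3 => i + i = 0).card = 1 from by decide]
      omega)
  obtain ⟨e'⟩ := nonempty_dihedral_three_mulEquiv_perm
  exact ⟨e.trans (MulEquiv.prodCongr (MulEquiv.refl _) (MulEquiv.prodCongr (MulEquiv.refl _) e'))⟩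

lemma pow_four_eq_one_of_card_eq_two_pow [Finite G] (h : ∀ g : G, g ^ 4 = 1 ∨ g ^ 6 = 1) {k : ℕ}
    (hcard : Nat.card G = 2 ^ k) (g : G) : g ^ 4 = 1 := by
  rcases h g with h | h
  · exact h
  · have h1 : g ^ 2 ^ k = 1 := by rw [← hcard, pow_card_eq_one']
    have h3 : orderOf g ∣ 6 := orderOf_dvd_of_pow_eq_one h
    have h4 : orderOf g ∣ 2 ^ k := orderOf_dvd_of_pow_eq_one h1
    have h5 : Nat.Coprime (orderOf g) 3 :=
      Nat.Coprime.coprime_dvd_left h4 (Nat.Coprime.pow_left k (by norm_num))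
    have h6 : orderOf g ∣ 2 := h5.dvd_of_dvd_mul_right (by simpa using h3)
    exact orderOf_dvd_iff_pow_eq_one.1 (h6.trans (by norm_num))

lemma orderOf_eq_four_of_sq_ne_one {g : G} (h4 : g ^ 4 = 1) (h2 : g ^ 2 ≠ 1) : orderOf g = 4 := by
  have : Fact (Nat.Prime 2) := ⟨Nat.prime_two⟩
  exact orderOf_eq_prime_pow (p := 2) (n := 1) (by simpa using h2) (by simpa using h4)

lemma nonempty_mulEquiv_of_card_eq_thirtytwo [Finite G] (h : ∀ g : G, g ^ 4 = 1 ∨ g ^ 6 = 1)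
    (h8 : (sqNeOne G).ncard = 8) (hcard : Nat.card G = 32) :
    Nonempty (G ≃* Cyc 2 × Cyc 2 × DihedralGroup 4) := by
  obtain ⟨x, hx2⟩ : (sqNeOne G).Nonempty := by
    rw [← Set.ncard_pos]
    omega
  have hx := orderOf_eq_four_of_sq_ne_one
    (pow_four_eq_one_of_card_eq_two_pow h (k := 5) (by rw [hcard]; norm_num) x) hx2
  have h1 := card_le_ncard_add_ncard_sqNeOne x
  have h2 := ncard_le_card_centralizer x
  have hI := ncard_sqNeOne_add_ncard G
  set C := Subgroup.centralizer {x} with hC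
  have hxC : x ∈ C := Subgroup.mem_centralizer_singleton_iff.2 rfl
  have hsub : {t : G | t ^ 2 = 1 ∧ (x * t) ^ 2 = 1} ⊆ (C : Set G)ᶜ :=
    fun t ht => notMem_centralizer_of_inverts hx2 ht.1 ht.2
  obtain ⟨s, hs⟩ : {t : G | t ^ 2 = 1 ∧ (x * t) ^ 2 = 1}.Nonempty := by
    rw [← Set.ncard_pos]
    omega
  have hsC : s ∉ C := hsub hs
  have hcC : Nat.card C = 16 := by
    have h4 := Subgroup.card_subgroup_dvd_card C
    have h6 : Nat.card C ≠ 32 := fun h => hsC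
      ((Subgroup.eq_top_of_card_eq C (h.trans hcard.symm)) ▸ Subgroup.mem_top s)
    rw [hcard] at h4
    have h7 := Nat.le_of_dvd (by norm_num) h4
    interval_cases Nat.card C <;> omega
  have h4 := ncard_inter_add_ncard_diff_sqOne C
  have h5 := ncard_compl_subgroup_of_index_eq_two (A := C) (by omega)
  -- At least `32 - 16 = 16` elements of square `1` invert `x`, which is the size of the complement.
  have heq := Set.eq_of_subset_of_ncard_le hsub (by omega) (Set.toFinite _)
  have hout : ∀ g ∉ C, g ^ 2 = 1 := by
    intro g hg
    have : g ∈ (C : Set G)ᶜ := hg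
    rw [← heq] at this
    exact this.1
  have h6 : {g : G | g ∉ C ∧ g ^ 2 = 1}.ncard ≤ ((C : Set G)ᶜ).ncard :=
    Set.ncard_le_ncard (fun g hg => hg.1) (Set.toFinite _)
  exact nonempty_mulEquiv_cyc_two_prod_cyc_two_prod_dihedral hout hxC hsC hx
    (by rw [hcard]) (by
      rw [show (Finset.univ.filter fun i : ZMod 4 => i + i = 0).card = 2 from by decide]
      omega)

end DihedralProducts

/-! ### Order twelve -/

section Twelve

variable {G : Type*} [Group G]

/-- The normal core of `P` is trivial because `|P|` is prime, so the action on the four cosets is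
faithful and its image has index `2` in `S₄`. -/
lemma nonempty_mulEquiv_alternatingGroup [Finite G] (hcard : Nat.card G = 12) {P : Subgroup G}
    (hP : Nat.card P = 3) (hn : ¬ P.Normal) : Nonempty (G ≃* alternatingGroup (Fin 4)) := by
  have hq : Nat.card (G ⧸ P) = 4 := by
    have := P.card_mul_index
    rw [hP, hcard, Subgroup.index_eq_card] at this
    omega
  have hcore : P.normalCore = ⊥ := by
    have h1 : Nat.card P.normalCore ∣ 3 := hP ▸ Subgroup.card_dvd_of_le P.normalCore_le
    rcases (Nat.dvd_prime Nat.prime_three).1 h1 with h2 | h2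
    · exact Subgroup.eq_bot_of_card_eq _ h2
    · refine absurd ?_ hn
      rw [← Subgroup.eq_of_le_of_card_ge P.normalCore_le (by omega)]
      infer_instance
  have hinj : Function.Injective (MulAction.toPermHom G (G ⧸ P)) := by
    rw [← MonoidHom.ker_eq_bot_iff, ← Subgroup.normalCore_eq_ker, hcore]
  let e : G ⧸ P ≃ Fin 4 := Finite.equivFinOfCardEq hq
  let f : G →* Equiv.Perm (Fin 4) :=
    (e.permCongrHom.toMonoidHom).comp (MulAction.toPermHom G (G ⧸ P))
  have hf : Function.Injective f := e.permCongrHom.injective.comp hinj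
  have hr : Nat.card f.range = 12 := by
    rw [← hcard]
    exact Nat.card_congr (MonoidHom.ofInjective hf).symm.toEquiv
  have hidx : f.range.index = 2 := by
    have := f.range.card_mul_index
    rw [hr, Nat.card_perm, Nat.card_fin] at this
    simp [Nat.factorial] at this
    omega
  have := Equiv.Perm.eq_alternatingGroup_of_index_eq_two hidx
  exact ⟨(MonoidHom.ofInjective hf).trans (MulEquiv.subgroupCongr this)⟩

/-- Otherwise the centralizer has order `6` and contains exactly two of the four elements of square
`1`. Some `v` outside it has square `1` and inverts `x`, so `v`, `v * x`, `v * x ^ 2` are three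
more. -/
lemma centralizer_eq_top_of_normal_zpowers [Finite G] (h8 : (sqNeOne G).ncard = 8)
    (hcard : Nat.card G = 12) {x : G} (hx : orderOf x = 3) (hn : (Subgroup.zpowers x).Normal) :
    Subgroup.centralizer {x} = ⊤ := by
  classical
  have := Fintype.ofFinite G
  have hconj : ∀ g, g * x * g⁻¹ = x ∨ g * x * g⁻¹ = x⁻¹ := by
    intro g
    have h1 := hn.conj_mem x (Subgroup.mem_zpowers x) g
    rw [mem_zpowers_iff_mem_range_orderOf, hx] at h1
    simp only [Finset.mem_image, Finset.mem_range] at h1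
    obtain ⟨i, hi, hi'⟩ := h1
    have hx3 : x ^ 3 = 1 := by rw [← hx, pow_orderOf_eq_one]
    have hx1 : x ≠ 1 := fun h => by simp [h] at hx
    interval_cases i
    · rw [pow_zero, eq_comm, mul_inv_eq_one] at hi'
      exact absurd (by simpa using hi') hx1
    · exact Or.inl (by rw [← hi', pow_one])
    · right
      rw [← hi']
      exact eq_inv_of_mul_eq_one_left (by rw [← pow_succ, hx3])
  by_contra hC
  obtain ⟨u, hu⟩ : ∃ u, u ∉ Subgroup.centralizer {x} := by
    by_contra! hcon
    exact hC ((Subgroup.eq_top_iff' _).2 hcon)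
  have h3 := three_mul_ncard_le_card_centralizer hx
  have hI := ncard_sqNeOne_add_ncard G
  have h4 := ncard_inter_add_ncard_diff_sqOne (Subgroup.centralizer {x})
  set C := Subgroup.centralizer {x} with hCdef
  have hmem : ∀ g, g ∈ C ↔ g * x * g⁻¹ = x := fun g => by
    rw [hCdef, Subgroup.mem_centralizer_singleton_iff, mul_inv_eq_iff_eq_mul]
  have hnot : ∀ g, g ∉ C → g * x * g⁻¹ = x⁻¹ := fun g hg =>
    (hconj g).resolve_left fun h => hg ((hmem g).2 h)
  have hidx : C.index = 2 := by
    rw [Subgroup.index_eq_two_iff]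
    refine ⟨u, fun b => ?_⟩
    by_cases hb : b ∈ C
    · exact Or.inr ⟨hb, fun hm => hu ((Subgroup.mul_mem_cancel_left _ hb).1 hm)⟩
    · refine Or.inl ⟨?_, hb⟩
      rw [hmem]
      calc b * u * x * (b * u)⁻¹ = b * (u * x * u⁻¹) * b⁻¹ := by group
        _ = (b * x * b⁻¹)⁻¹ := by rw [hnot u hu, conj_inv]
        _ = x := by rw [hnot b hb, inv_inv]
  have hcC : Nat.card C = 6 := by
    have := C.card_mul_index
    rw [hidx, hcard] at this
    omega
  have : Fact (Nat.Prime 2) := ⟨Nat.prime_two⟩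
  obtain ⟨⟨t, htC⟩, ht⟩ := exists_prime_orderOf_dvd_card' (G := C) 2 (by rw [hcC]; norm_num)
  rw [Subgroup.orderOf_mk] at ht
  have ht2 : t ^ 2 = 1 := by rw [← ht, pow_orderOf_eq_one]
  have ht1 : t ≠ 1 := fun h => by simp [h] at ht
  have h5 : 2 ≤ {g : G | g ∈ C ∧ g ^ 2 = 1}.ncard := by
    refine (Set.ncard_pair ht1).symm.le.trans (Set.ncard_le_ncard ?_ (Set.toFinite _))
    rintro g (rfl | rfl)
    · exact ⟨htC, ht2⟩
    · exact ⟨C.one_mem, one_pow 2⟩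
  obtain ⟨v, hv⟩ : {g : G | g ∉ C ∧ g ^ 2 = 1}.Nonempty := by
    rw [← Set.ncard_pos]
    omega
  have hxC : x ∈ C := (hmem x).2 (by simp)
  have h6 : 3 ≤ {g : G | g ∉ C ∧ g ^ 2 = 1}.ncard := by
    have h7 : (Set.univ : Set (Fin 3)).ncard = 3 := by simp [Set.ncard_univ]
    rw [← h7]
    refine Set.ncard_le_ncard_of_injOn (fun i => v * x ^ (i : ℕ)) (fun i _ => ⟨?_, ?_⟩) ?_
      (Set.toFinite _)
    · exact fun hm => hv.1 ((Subgroup.mul_mem_cancel_right _ (pow_mem hxC _)).1 hm)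
    · have h9 : v * x ^ (i : ℕ) * v⁻¹ = (x ^ (i : ℕ))⁻¹ := by
        rw [← conj_pow, hnot v hv.1, inv_pow]
      rw [mul_inv_eq_iff_eq_mul] at h9
      rw [sq]
      nth_rewrite 1 [h9]
      rw [mul_assoc, ← mul_assoc v, ← sq, hv.2, one_mul, inv_mul_cancel]
    · intro i _ j _ hij
      have := pow_eq_pow_iff_modEq.1 (mul_left_cancel hij)
      rw [hx] at this
      have h10 : (i : ℕ) % 3 = j % 3 := this
      omega
  omega

lemma nonempty_cyc_two_prod_cyc_three_mulEquiv : Nonempty (Cyc 2 × Cyc 3 ≃* Cyc 6) := by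
  have h1 : IsCyclic (Cyc 2 × Cyc 3) := by
    rw [Group.isCyclic_prod_iff]
    exact ⟨inferInstance, inferInstance, by simp; decide⟩
  exact ⟨mulEquivOfCyclicCardEq (by simp)⟩

lemma nonempty_mulEquiv_of_card_eq_twelve [Finite G] (h : ∀ g : G, g ^ 4 = 1 ∨ g ^ 6 = 1)
    (h8 : (sqNeOne G).ncard = 8) (hcard : Nat.card G = 12) :
    Nonempty (G ≃* alternatingGroup (Fin 4)) ∨ Nonempty (G ≃* Cyc 6 × Cyc 2) := by
  have : Fact (Nat.Prime 2) := ⟨Nat.prime_two⟩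
  obtain ⟨x, hx⟩ := exists_prime_orderOf_dvd_card' (G := G) 3 (hp := ⟨Nat.prime_three⟩)
    (by rw [hcard]; norm_num)
  by_cases hn : (Subgroup.zpowers x).Normal
  · right
    have hC := centralizer_eq_top_of_normal_zpowers h8 hcard hx hn
    have hx3 : x ^ 3 = 1 := by rw [← hx, pow_orderOf_eq_one]
    have hx1 : x ≠ 1 := fun h => by simp [h] at hx
    have hc : ∀ g, Commute g x := fun g =>
      Subgroup.mem_centralizer_singleton_iff.1 (hC ▸ Subgroup.mem_top g)
    obtain ⟨Q, hQ⟩ := Sylow.exists_subgroup_card_pow_prime (G := G) 2 (n := 2)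
      (by rw [hcard]; norm_num)
    norm_num at hQ
    -- Since `(q * x) ^ 4 = x ≠ 1`, it is the sixth power of `q * x` that is trivial.
    have hQ2 : ∀ q ∈ Q, q ^ 2 = 1 := by
      intro q hq
      have h4 : q ^ 4 = 1 := by
        have := pow_card_eq_one' (x := (⟨q, hq⟩ : Q))
        rw [hQ] at this
        simpa using congrArg Subtype.val this
      rcases h (q * x) with h5 | h5
      · rw [(hc q).mul_pow, h4, one_mul, pow_succ, hx3, one_mul] at h5
        exact absurd h5 hx1
      · rw [(hc q).mul_pow, show 6 = 4 + 2 from rfl, pow_add, h4, one_mul,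
          show 4 + 2 = 3 * 2 from rfl, pow_mul, hx3, one_pow, mul_one] at h5
        exact h5
    have hcyc : ∀ a : Cyc 3, a ^ 3 = 1 := by decide
    have hbot : Q ⊓ (cycHom 3 x hx3).range = ⊥ := by
      rw [Subgroup.eq_bot_iff_forall]
      rintro _ ⟨hq, ⟨a, rfl⟩⟩
      have h2 := hQ2 _ hq
      have h3 : cycHom 3 x hx3 a ^ 3 = 1 := by
        rw [← map_pow, hcyc, map_one]
      have : cycHom 3 x hx3 a ^ Nat.gcd 2 3 = 1 := pow_gcd_eq_one.2 ⟨h2, h3⟩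
      simpa using this
    obtain ⟨e⟩ := nonempty_mulEquiv_cyc_two_prod_cyc_two_prod (cycHom 3 x hx3)
      (cycHom_injective hx3 hx) Q hQ2 (fun q _ a => (commute_cycHom hx3 (hc q).symm a).symm)
      (by rw [hbot, Subgroup.card_bot, hQ]; norm_num) (by rw [hcard]; simp)
    obtain ⟨e'⟩ := nonempty_cyc_two_prod_cyc_three_mulEquiv
    exact ⟨(e.trans (MulEquiv.prodCongr (MulEquiv.refl _) e')).trans MulEquiv.prodComm⟩
  · exact Or.inl (nonempty_mulEquiv_alternatingGroup hcard
      (by rw [Nat.card_zpowers, hx]) hn)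

end Twelve

/-! ### Order sixteen -/

section Sixteen

variable {G : Type*} [Group G]

lemma cyc_two_eq_one_or (m : Cyc 2) : m = 1 ∨ m = Multiplicative.ofAdd 1 := by
  revert m; decide

lemma inv_eq_self_of_sq_eq_one {g : G} (h : g ^ 2 = 1) : g⁻¹ = g :=
  inv_eq_of_mul_eq_one_left (by rw [← sq, h])

lemma nonempty_mulEquiv_shear [Finite G] (hcard : Nat.card G = 16) {E : Subgroup G}
    (hE : ∀ g, g ∈ E ↔ g ^ 2 = 1) {c b : G} (hc : orderOf c = 4) (hb : b ∈ E)
    (hcb : c * b ≠ b * c) : Nonempty (G ≃* (Cyc 2 × Cyc 2) ⋊[shearAction] Cyc 4) := by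
  have hcE : c ∉ E := fun h => by
    have := orderOf_dvd_of_pow_eq_one ((hE c).1 h)
    rw [hc] at this
    omega
  have hEcomm : ∀ g ∈ E, ∀ k ∈ E, g * k = k * g := fun g hg k hk =>
    commute_of_sq_eq_one ((hE g).1 hg) ((hE k).1 hk) ((hE _).1 (mul_mem hg hk))
  have hEconj : ∀ g ∈ E, c * g * c⁻¹ ∈ E := fun g hg => by
    rw [hE, conj_pow, (hE g).1 hg, mul_one, mul_inv_cancel]
  have hc4 : c ^ 4 = 1 := by rw [← hc, pow_orderOf_eq_one]
  have hc2E : c ^ 2 ∈ E := by rw [hE, ← pow_mul, hc4]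
  -- The relation `c * b * c⁻¹ = a * b` forces `a` to be this commutator.
  obtain ⟨a, ha⟩ : ∃ a, a = c * b * c⁻¹ * b⁻¹ := ⟨_, rfl⟩
  have haE : a ∈ E := ha ▸ mul_mem (hEconj b hb) (inv_mem hb)
  have ha2 := (hE a).1 haE
  have hb2 := (hE b).1 hb
  have hcbc : c * b * c⁻¹ = a * b := by rw [ha, inv_mul_cancel_right]
  have ha1 : a ≠ 1 := fun h => hcb (by
    rw [h, one_mul, mul_inv_eq_iff_eq_mul] at hcbc
    exact hcbc)
  have hb1 : b ≠ 1 := fun h => hcb (by rw [h, mul_one, one_mul])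
  have hab : a ≠ b := fun h => hb1 (by
    rw [h, ← sq, hb2, mul_inv_eq_one] at hcbc
    simpa using hcbc)
  -- As `c ^ 2` lies in the abelian group `E`, conjugating `b` twice by `c` returns `b`.
  have hcac : c * a * c⁻¹ = a := by
    have h1 : c * (a * b) * c⁻¹ = b := by
      rw [← hcbc]
      calc c * (c * b * c⁻¹) * c⁻¹ = c ^ 2 * b * (c ^ 2)⁻¹ := by
            rw [sq, mul_inv_rev]; simp only [mul_assoc]
        _ = b := by rw [hEcomm _ hc2E b hb, mul_inv_cancel_right]
    rw [← conj_mul, hcbc, ← mul_assoc, mul_eq_right] at h1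
    rw [eq_inv_of_mul_eq_one_left h1, inv_eq_self_of_sq_eq_one ha2]
  have hf0 : Function.Injective (cycHom 2 b hb2) :=
    cycHom_injective hb2 (orderOf_eq_prime hb2 hb1)
  have hcomm : ∀ m n, Commute (cycHom 2 a ha2 m) (cycHom 2 b hb2 n) := fun m n =>
    commute_cycHom ha2 (commute_cycHom hb2 (hEcomm b hb a haE) n).symm m
  have hf1 : Function.Injective
      (MonoidHom.noncommCoprod (cycHom 2 a ha2) (cycHom 2 b hb2) hcomm) := by
    refine noncommCoprod_cycHom_injective a ha2 _ hf0 ?_ hcomm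
    rintro ⟨m, hm⟩
    rcases cyc_two_eq_one_or m with rfl | rfl
    · exact ha1 (by rw [← hm, map_one])
    · exact hab (by rw [← hm, cycHom_one])
  refine nonempty_mulEquiv_of_injective _
    (SemidirectProduct.lift_injective_of_disjoint _ (cycHom 4 c hc4)
    (semidirect_compat_of_generator _ c hc4 ?_) hf1 (cycHom_injective hc4 hc) ?_) ?_
  · have s1 : shearAction (Multiplicative.ofAdd 1) (Multiplicative.ofAdd 1, 1) =
      (Multiplicative.ofAdd 1, 1) := by decide
    have s2 : shearAction (Multiplicative.ofAdd 1) (1, Multiplicative.ofAdd 1) =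
      (Multiplicative.ofAdd 1, Multiplicative.ofAdd 1) := by decide
    have s3 : shearAction (Multiplicative.ofAdd 1) (Multiplicative.ofAdd 1, Multiplicative.ofAdd 1)
      = (1, Multiplicative.ofAdd 1) := by decide
    rintro ⟨m, n⟩
    rcases cyc_two_eq_one_or m with rfl | rfl <;> rcases cyc_two_eq_one_or n with rfl | rfl
    · rw [← Prod.one_eq_mk, map_one, map_one, mul_one, mul_inv_cancel]
    · simp only [s2, MonoidHom.noncommCoprod_apply, cycHom_one, map_one, one_mul, hcbc]
    · simp only [s1, MonoidHom.noncommCoprod_apply, cycHom_one, map_one, mul_one, hcac]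
    · simp only [s3, MonoidHom.noncommCoprod_apply, cycHom_one, map_one, one_mul]
      rw [← conj_mul, hcac, hcbc, ← mul_assoc, ← sq, ha2, one_mul]
  · rw [Subgroup.disjoint_def]
    rintro _ ⟨⟨m, n⟩, rfl⟩ ⟨k, hk⟩
    have hcyc : ∀ k : Cyc 4, k = 1 ∨ k = Multiplicative.ofAdd 1 ∨ k = Multiplicative.ofAdd 1 ^ 2 ∨
      k = (Multiplicative.ofAdd 1)⁻¹ := by decide
    have hmem : MonoidHom.noncommCoprod (cycHom 2 a ha2) (cycHom 2 b hb2) hcomm (m, n) ∈ E := by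
      rw [MonoidHom.noncommCoprod_apply]
      exact mul_mem ((Subgroup.zpowers_le.2 haE) (cycHom_mem_zpowers ha2 _))
        ((Subgroup.zpowers_le.2 hb) (cycHom_mem_zpowers hb2 _))
    rcases hcyc k with rfl | rfl | rfl | rfl
    · rw [← hk, map_one]
    · rw [cycHom_one] at hk
      exact absurd (hk ▸ hmem) hcE
    · exfalso
      rw [map_pow, cycHom_one, MonoidHom.noncommCoprod_apply] at hk
      have hcc : c * c ^ 2 * c⁻¹ = c ^ 2 := by
        rw [mul_inv_eq_iff_eq_mul, ← pow_succ, ← pow_succ']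
      rcases cyc_two_eq_one_or m with rfl | rfl <;> rcases cyc_two_eq_one_or n with rfl | rfl <;>
        simp only [cycHom_one, map_one, one_mul, mul_one] at hk
      · exact hcE ((hE c).2 hk)
      · rw [hk, hcbc, mul_eq_right] at hcc
        exact ha1 hcc
      -- If `c ^ 2 = a`, then `b * c` has square `1`, so it lies in `E`, and so does `c`.
      · have h1 : b * c ∈ E := by
          rw [hE, sq]
          calc b * c * (b * c) = b * (c * b * c⁻¹) * c ^ 2 := by
                rw [sq]; simp only [mul_assoc, inv_mul_cancel_left]
            _ = 1 := by
                rw [hcbc, hk, hEcomm a haE b hb, ← mul_assoc, ← sq, hb2, one_mul, ← sq, ha2]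
        exact hcE ((Subgroup.mul_mem_cancel_left _ hb).1 h1)
      · rw [hk, ← conj_mul, hcac, hcbc, mul_right_inj, mul_eq_right] at hcc
        exact ha1 hcc
    · rw [map_inv, cycHom_one] at hk
      exact absurd (inv_mem_iff.1 (hk ▸ hmem)) hcE
  · rw [SemidirectProduct.card, hcard]
    simp

lemma nonempty_mulEquiv_of_forall_commute [Finite G] (hcard : Nat.card G = 16) {E : Subgroup G}
    (hE : ∀ g, g ∈ E ↔ g ^ 2 = 1) (hE8 : Nat.card E = 8) {c : G} (hc : orderOf c = 4)
    (hcomm : ∀ b ∈ E, c * b = b * c) : Nonempty (G ≃* Cyc 4 × Cyc 2 × Cyc 2) := by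
  have hc4 : c ^ 4 = 1 := by rw [← hc, pow_orderOf_eq_one]
  have hinj := cycHom_injective hc4 hc
  obtain ⟨e⟩ := nonempty_mulEquiv_cyc_two_prod_cyc_two_prod (cycHom 4 c hc4) hinj E
    (fun e he => (hE e).1 he) (fun e he a => (commute_cycHom hc4 (hcomm e he) a).symm) (by
      have h2 : (Finset.univ.filter fun a : Cyc 4 => a ^ 2 = 1).card = 2 := by decide
      have h3 : Nat.card (E ⊓ (cycHom 4 c hc4).range : Subgroup G) ≤ 2 := by
        rw [← h2, ← SetLike.coe_sort_coe, Nat.card_coe_set_eq, ← Set.ncard_coe_finset]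
        refine (Set.ncard_le_ncard ?_ (Set.toFinite _)).trans
          (Set.ncard_image_le (f := cycHom 4 c hc4) (Set.toFinite _))
        rintro _ ⟨hg, ⟨a, rfl⟩⟩
        refine ⟨a, ?_, rfl⟩
        have hg2 := (hE _).1 hg
        rw [← map_pow, map_eq_one_iff _ hinj] at hg2
        simpa using hg2
      omega) (by rw [hcard]; simp)
  exact ⟨e.trans (MulEquiv.prodAssoc.symm.trans MulEquiv.prodComm)⟩

lemma nonempty_mulEquiv_quaternion_semidirect [Finite G] (hcard : Nat.card G = 16)
    {x s u : G} (hx : orderOf x = 4) (hu2 : u ^ 2 = 1) (hux : u * x = x * u)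
    (hsx : s * x = x⁻¹ * s) (hsu : s * u * s = u * x ^ 2) (hs2 : s ^ 2 = 1)
    (hsmem : s ∉ Subgroup.zpowers x) (hu : u ∉ Subgroup.zpowers x)
    (hus : u * s ∉ Subgroup.zpowers x) :
    Nonempty (G ≃* QuaternionGroup 2 ⋊[conjAction] Cyc 2) := by
  have hx4 : x ^ (2 * 2) = 1 := by
    have := pow_orderOf_eq_one x
    rwa [hx] at this
  have hsq : u * s * (u * s) = x ^ 2 := by
    calc u * s * (u * s) = u * (s * u * s) := by simp only [mul_assoc]
      _ = x ^ 2 := by rw [hsu, ← mul_assoc, ← sq, hu2, one_mul]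
  have husx : u * s * x = x⁻¹ * (u * s) := by
    rw [mul_assoc, hsx, ← mul_assoc, (show Commute u x from hux).inv_right.eq, mul_assoc]
  have husu : u * (u * s) * u⁻¹ = u * s * x ^ 2 := by
    have h1 : s * u = u * x ^ 2 * s := by
      rw [← hsu, mul_assoc _ s s, ← sq, hs2, mul_one]
    have h2 : x ^ 2 * s = s * x ^ 2 := by
      have h3 : SemiconjBy s x x⁻¹ := hsx
      rw [(h3.pow_right 2).eq, inv_pow]
      congr 1
      rw [eq_inv_iff_mul_eq_one, ← pow_add, hx4]
    rw [← mul_assoc u u, ← sq, hu2, one_mul, inv_eq_self_of_sq_eq_one hu2, h1, mul_assoc, h2,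
      mul_assoc]
  have hu1 : u ≠ 1 := fun h => hu (h ▸ one_mem _)
  have ha : ∀ i : ZMod (2 * 2), conjAction (Multiplicative.ofAdd 1) (QuaternionGroup.a i) =
    QuaternionGroup.a i := by decide
  have hxa : ∀ i : ZMod (2 * 2), conjAction (Multiplicative.ofAdd 1) (QuaternionGroup.xa i) =
    QuaternionGroup.xa (2 + i) := by decide
  have hcyc2 : cycHom (2 * 2) x hx4 (Multiplicative.ofAdd 2) = x ^ 2 := by
    have := cycHom_intCast hx4 2
    simpa using this
  refine nonempty_mulEquiv_of_injective _
    (SemidirectProduct.lift_injective_of_disjoint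
    (quaternionHom 2 x (u * s) hx4 hsq husx) (cycHom 2 u hu2)
    (semidirect_compat_of_generator _ u hu2 ?_)
    (quaternionHom_injective hx4 hsq husx hx hus)
    (cycHom_injective hu2 (orderOf_eq_prime hu2 hu1)) ?_) ?_
  · have hcu : ∀ i, Commute (cycHom (2 * 2) x hx4 i) u := commute_cycHom hx4 hux.symm
    rintro (i | i)
    · rw [ha]
      change cycHom (2 * 2) x hx4 _ = u * cycHom (2 * 2) x hx4 _ * u⁻¹
      rw [← (hcu _).eq, mul_inv_cancel_right]
    · rw [hxa]
      change u * s * cycHom (2 * 2) x hx4 _ = u * (u * s * cycHom (2 * 2) x hx4 _) * u⁻¹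
      rw [ofAdd_add, map_mul, hcyc2, ← mul_assoc, ← husu]
      have := (hcu (Multiplicative.ofAdd i)).inv_right.eq
      simp only [mul_assoc, this]
  · rw [Subgroup.disjoint_def]
    rintro _ ⟨m, rfl⟩ ⟨k, hk⟩
    rcases cyc_two_eq_one_or k with rfl | rfl
    · rw [← hk, map_one]
    · exfalso
      rw [cycHom_one] at hk
      rcases m with i | i
      · exact hu (hk ▸ cycHom_mem_zpowers hx4 _)
      · have h1 : u = u * s * cycHom (2 * 2) x hx4 (Multiplicative.ofAdd i) := hk
        rw [mul_assoc, left_eq_mul] at h1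
        exact hsmem (eq_inv_of_mul_eq_one_left h1 ▸ inv_mem (cycHom_mem_zpowers hx4 _))
  · rw [SemidirectProduct.card, hcard, Nat.card_eq_fintype_card (α := QuaternionGroup 2),
      QuaternionGroup.card]
    simp

/-- Here `D = ⟨s, t⟩` is dihedral of order `8` and has six of the eight elements of square `1`; the
other two are `u` and `u * x ^ 2`. Both `s` and `t` swap these, so `x = s * t` commutes with `u`.
Then `x` and `u * s` generate a quaternion group on which `u` acts as conjugation by `x`. -/
lemma nonempty_mulEquiv_of_sq_mul_ne_one [Finite G] (hcard : Nat.card G = 16)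
    (h4 : ∀ g : G, g ^ 4 = 1) (h8 : {g : G | g ^ 2 = 1}.ncard = 8) {s t : G} (hs : s ^ 2 = 1)
    (ht : t ^ 2 = 1) (hst : (s * t) ^ 2 ≠ 1) :
    Nonempty (G ≃* QuaternionGroup 2 ⋊[conjAction] Cyc 2) := by
  obtain ⟨x, hxst⟩ : ∃ x, x = s * t := ⟨_, rfl⟩
  rw [← hxst] at hst
  have hx := orderOf_eq_four_of_sq_ne_one (h4 x) hst
  have hss : s * s = 1 := by rw [← sq, hs]
  have hsinv := inv_eq_self_of_sq_eq_one hs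
  have htinv := inv_eq_self_of_sq_eq_one ht
  have hsx' : s * x = t := by rw [hxst, ← mul_assoc, hss, one_mul]
  have hsx : s * x = x⁻¹ * s := by
    rw [hsx', hxst, mul_inv_rev, hsinv, htinv, mul_assoc, hss, mul_one]
  have hnot : ∀ g : G, g ^ 2 = 1 → s * x = g ∨ s = g → g ∉ Subgroup.zpowers x := by
    rintro g - hg ⟨k, hk⟩
    have hsz : s ∈ Subgroup.zpowers x := by
      rcases hg with rfl | rfl
      · exact (Subgroup.mul_mem_cancel_right _ (Subgroup.mem_zpowers x)).1 ⟨k, hk⟩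
      · exact ⟨k, hk⟩
    obtain ⟨j, hj⟩ := hsz
    simp only at hj
    have h1 : s * x = x * s := by rw [← hj, ← zpow_add_one, ← zpow_one_add, add_comm]
    rw [hsx, mul_left_inj] at h1
    exact hst (by rw [sq]; nth_rewrite 1 [← h1]; simp)
  have hsmem := hnot s hs (Or.inr rfl)
  have htmem := hnot t ht (Or.inl hsx')
  have hinj := dihedralHom_injective (h4 x) hss hsx hx hsmem
  obtain ⟨D, hD⟩ : ∃ D, D = (dihedralHom 4 x s (h4 x) hss hsx).range := ⟨_, rfl⟩
  have hDcard : Nat.card D = 8 := by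
    rw [hD, Nat.card_congr (MonoidHom.ofInjective hinj).symm.toEquiv, DihedralGroup.nat_card]
  have hDidx : D.index = 2 := by
    have := D.card_mul_index
    rw [hDcard, hcard] at this
    omega
  have hDn := Subgroup.normal_of_index_eq_two hDidx
  have hr1 : dihedralHom 4 x s (h4 x) hss hsx (DihedralGroup.r 1) = x := cycHom_one (h4 x)
  have hs0 : dihedralHom 4 x s (h4 x) hss hsx (DihedralGroup.sr 0) = s := by
    change s * cycHom 4 x (h4 x) (Multiplicative.ofAdd 0) = s
    rw [ofAdd_zero, map_one, mul_one]
  have hxD : x ∈ D := hD ▸ ⟨_, hr1⟩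
  have hsD : s ∈ D := hD ▸ ⟨_, hs0⟩
  have htD : t ∈ D := hsx' ▸ mul_mem hsD hxD
  have hI6 : {g : G | g ∈ D ∧ g ^ 2 = 1}.ncard = 6 := by
    have h6 : (Finset.univ.filter fun d : DihedralGroup 4 => d * d = 1).card = 6 := by decide
    rw [← h6, ← Set.ncard_coe_finset, ← Set.ncard_image_of_injective _ hinj, hD]
    congr 1
    ext g
    constructor
    · rintro ⟨⟨d, rfl⟩, hd⟩
      refine ⟨d, ?_, rfl⟩
      rw [← map_pow, map_eq_one_iff _ hinj, sq] at hd
      simpa using hd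
    · rintro ⟨d, hd, rfl⟩
      refine ⟨⟨d, rfl⟩, ?_⟩
      have hd' : d * d = 1 := by simpa using hd
      rw [← map_pow, sq, hd', map_one]
  have hsum := ncard_inter_add_ncard_diff_sqOne D
  rw [hI6, h8] at hsum
  obtain ⟨u, huD, hu2⟩ : {g : G | g ∉ D ∧ g ^ 2 = 1}.Nonempty := by
    rw [← Set.ncard_pos]
    omega
  -- Conjugation by `u` preserves `D`, in which `x ^ 2` is the only nontrivial square.
  have hux2 : u * x ^ 2 * u⁻¹ = x ^ 2 := by
    have h1 := hDn.conj_mem x hxD u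
    rw [hD] at h1
    obtain ⟨d, hd⟩ := h1
    have hdd : d ^ 2 ≠ 1 := by
      intro h
      have h2 := congrArg (· ^ 2) hd
      simp only [← map_pow, h, map_one, conj_pow] at h2
      rw [eq_comm, mul_inv_eq_one, mul_eq_left] at h2
      exact hst h2
    have hr : ∀ d : DihedralGroup 4, d ^ 2 ≠ 1 → d ^ 2 = DihedralGroup.r 1 ^ 2 := by decide
    rw [← conj_pow, ← hd, ← map_pow, hr d hdd, map_pow, hr1]
  have hz : u * x ^ 2 = x ^ 2 * u := mul_inv_eq_iff_eq_mul.1 hux2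
  have hzz : x ^ 2 * x ^ 2 = 1 := by rw [← pow_add, h4]
  have hpair : ({u, u * x ^ 2} : Set G) = {g : G | g ∉ D ∧ g ^ 2 = 1} := by
    refine Set.eq_of_subset_of_ncard_le ?_ ?_ (Set.toFinite _)
    · rintro g (rfl | rfl)
      · exact ⟨huD, hu2⟩
      · refine ⟨fun hm => huD ((Subgroup.mul_mem_cancel_right _ (pow_mem hxD 2)).1 hm), ?_⟩
        rw [(show Commute u (x ^ 2) from hz).mul_pow, hu2, one_mul, sq, hzz]
    · rw [Set.ncard_pair fun h => hst (left_eq_mul.1 h)]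
      omega
  have hout : ∀ g, g ∉ D → g ^ 2 = 1 → g = u ∨ g = u * x ^ 2 := by
    intro g hg hg2
    have : g ∈ ({u, u * x ^ 2} : Set G) := hpair ▸ ⟨hg, hg2⟩
    exact this
  -- If `v` fixed `u`, then `u * v` would have square `1` outside `D`, so it would be `u` or `u * x
  -- ^ 2`, putting `v` in `⟨x⟩`.
  have hact : ∀ v ∈ D, v ^ 2 = 1 → v ∉ Subgroup.zpowers x → v * u * v = u * x ^ 2 := by
    intro v hv hv2 hvx
    have hvinv := inv_eq_self_of_sq_eq_one hv2
    have h1 := hout (v * u * v)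
      (fun hm => huD ((Subgroup.mul_mem_cancel_left _ hv).1
        ((Subgroup.mul_mem_cancel_right _ hv).1 hm)))
      (by nth_rewrite 2 [← hvinv]; rw [conj_pow, hu2, mul_one, mul_inv_cancel])
    refine h1.resolve_left fun h2 => ?_
    have h3 : v * u = u * v := by
      nth_rewrite 2 [← hvinv] at h2
      exact mul_inv_eq_iff_eq_mul.1 h2
    have h5 := hout (u * v) (fun hm => huD ((Subgroup.mul_mem_cancel_right _ hv).1 hm))
      (by rw [(show Commute u v from h3.symm).mul_pow, hu2, hv2, one_mul])
    rcases h5 with h5 | h5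
    · rw [mul_eq_left] at h5
      exact hvx (h5 ▸ one_mem _)
    · rw [mul_right_inj] at h5
      exact hvx (h5 ▸ pow_mem (Subgroup.mem_zpowers x) 2)
  have hsu := hact s hsD hs hsmem
  have htu := hact t htD ht htmem
  have hxz : Subgroup.zpowers x ≤ D := Subgroup.zpowers_le.2 hxD
  have hzs : x ^ 2 * s = s * x ^ 2 := by
    have h3 : SemiconjBy s x x⁻¹ := hsx
    rw [(h3.pow_right 2).eq, inv_pow]
    congr 1
    exact (inv_eq_of_mul_eq_one_left hzz).symm
  have hxu : x * u * x⁻¹ = u := by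
    calc x * u * x⁻¹ = s * (t * u * t) * s := by
          rw [hxst, mul_inv_rev, hsinv, htinv]; simp only [mul_assoc]
      _ = s * u * s * x ^ 2 := by rw [htu]; simp only [mul_assoc, hzs]
      _ = u := by rw [hsu, mul_assoc, hzz, mul_one]
  exact nonempty_mulEquiv_quaternion_semidirect hcard hx hu2
    (mul_inv_eq_iff_eq_mul.1 hxu).symm hsx hsu hs hsmem (fun h => huD (hxz h))
    (fun h => huD ((Subgroup.mul_mem_cancel_right _ hsD).1 (hxz h)))

lemma nonempty_mulEquiv_of_card_eq_sixteen [Finite G] (h : ∀ g : G, g ^ 4 = 1 ∨ g ^ 6 = 1)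
    (h8 : (sqNeOne G).ncard = 8) (hcard : Nat.card G = 16) :
    Nonempty (G ≃* Cyc 4 × Cyc 2 × Cyc 2) ∨
      Nonempty (G ≃* (Cyc 2 × Cyc 2) ⋊[shearAction] Cyc 4) ∨
      Nonempty (G ≃* QuaternionGroup 2 ⋊[conjAction] Cyc 2) := by
  have h4 := pow_four_eq_one_of_card_eq_two_pow h (k := 4) (by rw [hcard]; norm_num)
  have hI : {g : G | g ^ 2 = 1}.ncard = 8 := by
    have := ncard_sqNeOne_add_ncard G
    omega
  by_cases hclosed : ∀ s t : G, s ^ 2 = 1 → t ^ 2 = 1 → (s * t) ^ 2 = 1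
  · let E : Subgroup G :=
      { carrier := {g | g ^ 2 = 1}
        one_mem' := one_pow 2
        mul_mem' := fun {a b} ha hb => hclosed a b ha hb
        inv_mem' := fun {a} ha => by
          change a⁻¹ ^ 2 = 1
          rw [inv_pow, show a ^ 2 = 1 from ha, inv_one] }
    have hE : ∀ g, g ∈ E ↔ g ^ 2 = 1 := fun g => Iff.rfl
    have hE8 : Nat.card E = 8 := by
      rw [← hI, ← SetLike.coe_sort_coe, Nat.card_coe_set_eq]
      rfl
    obtain ⟨c, hc⟩ : (sqNeOne G).Nonempty := by
      rw [← Set.ncard_pos]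
      omega
    have hc4 := orderOf_eq_four_of_sq_ne_one (h4 c) hc
    by_cases hcomm : ∀ b ∈ E, c * b = b * c
    · exact Or.inl (nonempty_mulEquiv_of_forall_commute hcard hE hE8 hc4 hcomm)
    · push Not at hcomm
      obtain ⟨b, hb, hcb⟩ := hcomm
      exact Or.inr (Or.inl (nonempty_mulEquiv_shear hcard hE hc4 hb hcb))
  · push Not at hclosed
    obtain ⟨s, t, hs, ht, hst⟩ := hclosed
    exact Or.inr (Or.inr (nonempty_mulEquiv_of_sq_mul_ne_one hcard h4 hI hs ht hst))

end Sixteen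

theorem theorem4 (G : Type*) [Group G] [Finite G] :
    {H : Subgroup G | IsCyclic H}.ncard + 4 = Nat.card G ↔
      (Nonempty (G ≃* Cyc 4 × Cyc 2 × Cyc 2) ∨
       Nonempty (G ≃* Cyc 2 × Cyc 2 × DihedralGroup 4) ∨
       Nonempty (G ≃* (Cyc 2 × Cyc 2) ⋊[shearAction] Cyc 4) ∨
       Nonempty (G ≃* QuaternionGroup 2 ⋊[conjAction] Cyc 2) ∨
       Nonempty (G ≃* Cyc 3 × Cyc 3) ∨
       Nonempty (G ≃* (Cyc 3 × Cyc 3) ⋊[invAction] Cyc 2) ∨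
       Nonempty (G ≃* alternatingGroup (Fin 4)) ∨
       Nonempty (G ≃* Cyc 6 × Cyc 2) ∨
       Nonempty (G ≃* Cyc 2 × Cyc 2 × Equiv.Perm (Fin 3)) ∨
       Nonempty (G ≃* Cyc 8) ∨
       Nonempty (G ≃* DihedralGroup 8)) := by
  refine ⟨fun hG => ?_, ncard_isCyclic_of_listed_mulEquiv⟩
  rcases ncard_sqNeOne_eq_eight_or_orderOf_eq_eight hG with ⟨h, h8⟩ | h | h
  · rcases card_cases h h8 with hc | hc | hc | hc | hc | hc
    · have := nonempty_mulEquiv_of_card_eq_nine h hc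
      tauto
    · have := nonempty_mulEquiv_of_card_eq_twelve h h8 hc
      tauto
    · have := nonempty_mulEquiv_of_card_eq_sixteen h h8 hc
      tauto
    · have := nonempty_mulEquiv_of_card_eq_eighteen h h8 hc
      tauto
    · have := nonempty_mulEquiv_of_card_eq_twentyfour h8 hc
      tauto
    · have := nonempty_mulEquiv_of_card_eq_thirtytwo h h8 hc
      tauto
  · tauto
  · tauto
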